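/- \textbf{Setting.} Let $\mathcal X$ be a measurable space with measurable diagonal (for instance $\mathcal X\subseteq\mathbb R^{d}$). Let $p$ be a prior probability distribution on $\mathcal X$ and $x\mapsto p(y\mid x)\in[0,\infty)$ a measurable likelihood of the observed data $y$ with $\int p(y\mid x)\,p(dx)>0$. Let $S\ge 0$, $0=\alpha_0<\alpha_1<\dots<\alpha_S<1$, and let $\pi_\alpha(dx)\propto p(y\mid x)^\alpha\,p(dx)$. For $s=1,\dots,S$ let $P_s$ be a Markov kernel on $\mathcal X$ that leaves $\pi_{\alpha_s}$ invariant, $m_s$ a number of steps, and $\bar P_s$ a faithful coupling of two copies of $P_s$, i.e. a Markov kernel on $\mathcal X\times\mathcal X$ such that both marginals of $\bar P_s((x,\bar x),\cdot)$ are $P_s(x,\cdot)$ and $P_s(\bar x,\cdot)$, and $\bar P_s((x,x),\cdot)$ is concentrated on the diagonal. Nothing else is assumed about the quality of the coupling. \textbf{Coupled resampling} from probability vectors $p_{1:N},\bar p_{1:N}$: let $p^{\min}_i=\min(p_i,\bar p_i)$ and $a=\sum_i p_i^{\min}$; with probability $a$ draw $i$ from $p^{\min}_{1:N}/a$ and set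 $\bar i=i$; with probability $1-a$ draw $i$ and $\bar i$ independently from $(p_{1:N}-p^{\min}_{1:N})/(1-a)$ and $(\bar p_{1:N}-p^{\min}_{1:N})/(1-a)$. Probability vectors proportional to weights are taken uniform when all the weights vanish. \textbf{Coupled conditional SMC step} with $N$ particles from $(x_{0:S},\bar x_{0:S})\in\mathcal X^{S+1}\times\mathcal X^{S+1}$: set $x^1_s=x_s$, $\bar x^1_s=\bar x_s$ for all $s$; draw $x_0^{2},\dots,x_0^N$ independently from $p$ and set $\bar x_0^i=x_0^i$ for $i\ge2$. For $s=1,\dots,S$, independently for each $i=2,\dots,N$ given the particles of stage $s-1$, draw a pair of ancestors by coupled resampling from $x_{s-1}^{1:N}$ and $\bar x_{s-1}^{1:N}$ with probabilities proportional to $p(y\mid x_{s-1}^j)^{\alpha_s-\alpha_{s-1}}$ and $p(y\mid \bar x_{s-1}^j)^{\alpha_s-\alpha_{s-1}}$, and move the resulting pair by $m_s$ steps of $\bar P_s$. Finally, draw a pair of particles by coupled resampling with probabilities proportional to $p(y\mid x_S^j)^{1-\alpha_S}$ and $p(y\mid\bar x_S^j)^{1-\alpha_S}$, and output their ancestral lineages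 $(x'_{0:S},\bar x'_{0:S})$. \textbf{Coupled particle MCMC with conditional SMC only} ($\rho=0$): draw $x_{0:S}(0)$ by the SMC sampler (the same scheme for a single system of $N$ particles, without reference trajectory: initial draws from $p$, multinomial resampling, $m_s$ steps of $P_s$; output the ancestral lineage of one final draw), set $\bar x_{0:S}(1)=x_{0:S}(0)$, draw $x_{0:S}(1)$ given $x_{0:S}(0)$ by conditional SMC (the first component of coupled conditional SMC started from $(x_{0:S}(0),x_{0:S}(0))$), and for $t\ge2$ draw $(x_{0:S}(t),\bar x_{0:S}(t))$ by a coupled conditional SMC step from $(x_{0:S}(t-1),\bar x_{0:S}(t-1))$. Let $\tau=\inf\{t\ge1: x_{0:S}(t)=\bar x_{0:S}(t)\}$. \textbf{Proposition.} Suppose that the likelihood is bounded, $\sup_{x\in\mathcal X}p(y\mid x)<\infty$. Then, for any number of temperatures $S\ge0$ (and any model and algorithm as above), there is a constant $0\le c<\infty$ such that for all $N\ge2$: (i) for every initial pair $(x_{0:S},\bar x_{0:S})\in\mathcal X^{S+1}\times\mathcal X^{S+1}$, the output of one coupled conditional SMC step satisfies $\Pr(x'_{0:S}=\bar x'_{0:S})\ge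 N/(N+c)$; (ii) $\tau<\infty$ almost surely; (iii) $E(\tau)\le 2+c/N$. Here (ii) and (iii) hold both for the algorithm with its own initialization and when $(x_{0:S}(1),\bar x_{0:S}(1))$ has an arbitrary (in particular, deterministic) law. -/

import Mathlib

open MeasureTheory ProbabilityTheory
open scoped NNReal ENNReal

noncomputable section

/-! ### Finite products of Markov kernels -/

/-- Given `a`, draw independently one point from each `κ i a`. -/
def kernelPi {A B : Type*} [MeasurableSpace A] [MeasurableSpace B] {N : ℕ}
    (κ : Fin N → Kernel A B) [∀ i, IsMarkovKernel (κ i)] : Kernel A (Fin N → B) where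
  toFun a := Measure.pi fun i => κ i a
  measurable' := by
    refine Measurable.measure_of_isPiSystem_of_isProbabilityMeasure
      generateFrom_pi.symm isPiSystem_pi ?_
    rintro _ ⟨s, hs, rfl⟩
    simp only [Measure.pi_pi]
    exact Finset.measurable_prod _ fun i _ => (κ i).measurable_coe (hs i (Set.mem_univ i))

instance {A B : Type*} [MeasurableSpace A] [MeasurableSpace B] {N : ℕ}
    (κ : Fin N → Kernel A B) [∀ i, IsMarkovKernel (κ i)] : IsMarkovKernel (kernelPi κ) :=
  ⟨fun a => (inferInstance : IsProbabilityMeasure (Measure.pi fun i => κ i a))⟩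

instance {A : Type*} [MeasurableSpace A] (κ : Kernel A A) [IsMarkovKernel κ] (m : ℕ) :
    IsMarkovKernel (κ ^ m) := by
  induction m with
  | zero => exact (inferInstance : IsMarkovKernel (Kernel.id : Kernel A A))
  | succ m ih => rw [pow_succ]; exact (inferInstance : IsMarkovKernel ((κ ^ m) ∘ₖ κ))

/-! ### Multinomial resampling and its maximal coupling -/

/-- The probability vector proportional to the weights `w`. If all weights vanish it is, by
convention, the uniform one. -/
def probVector {N : ℕ} (w : Fin N → ℝ≥0) (i : Fin N) : ℝ≥0 :=
  if ∑ j, w j = 0 then (N : ℝ≥0)⁻¹ else w i / ∑ j, w j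

/-- The overlap `∑ i, min (p i) (q i)` of two probability vectors. -/
def overlap {N : ℕ} (p q : Fin N → ℝ≥0) : ℝ≥0 := ∑ i, min (p i) (q i)

/-- Coupled resampling: the probability of drawing the pair of indices `(i, j)`. With probability
`a = overlap p q`, draw `i` from `min p q / a` and set `j = i`; with probability `1 - a`, draw `i`
and `j` independently from `(p - min p q) / (1 - a)` and `(q - min p q) / (1 - a)`. -/
def coupledResampling {N : ℕ} (p q : Fin N → ℝ≥0) (i j : Fin N) : ℝ≥0 :=
  overlap p q * (if i = j then min (p i) (q i) / overlap p q else 0) +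
    (1 - overlap p q) * ((p i - min (p i) (q i)) / (1 - overlap p q) *
      ((q j - min (p j) (q j)) / (1 - overlap p q)))

theorem sum_probVector {N : ℕ} [NeZero N] (w : Fin N → ℝ≥0) : ∑ i, probVector w i = 1 := by
  unfold probVector
  split_ifs with h
  · simp [NeZero.ne N]
  · rw [← Finset.sum_div, div_self h]

theorem sum_sub_min {N : ℕ} (p q : Fin N → ℝ≥0) (hp : ∑ i, p i = 1) :
    ∑ i, (p i - min (p i) (q i)) = 1 - overlap p q := by
  rw [Finset.sum_tsub_distrib _ fun i _ => min_le_left _ _, hp, overlap]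

theorem sum_coupledResampling {N : ℕ} (p q : Fin N → ℝ≥0) (hp : ∑ i, p i = 1)
    (hq : ∑ i, q i = 1) : ∑ i, ∑ j, coupledResampling p q i j = 1 := by
  have hle : overlap p q ≤ 1 := hp ▸ Finset.sum_le_sum fun i _ => min_le_left _ _
  have h1 : ∑ i, min (p i) (q i) / overlap p q = overlap p q / overlap p q := by
    rw [← Finset.sum_div]; rfl
  have h2 : ∑ i, (p i - min (p i) (q i)) / (1 - overlap p q)
      = (1 - overlap p q) / (1 - overlap p q) := by
    rw [← Finset.sum_div, sum_sub_min p q hp]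
  have h3 : ∑ i, (q i - min (p i) (q i)) / (1 - overlap p q)
      = (1 - overlap p q) / (1 - overlap p q) := by
    have := sum_sub_min q p hq
    simp only [overlap, min_comm (q _)] at this
    rw [← Finset.sum_div, this, overlap]
  unfold coupledResampling
  simp only [Finset.sum_add_distrib, ← Finset.mul_sum, Finset.sum_ite_eq, Finset.mem_univ,
    if_true, ← Finset.sum_mul, h1, h2, h3]
  have e : ∀ a : ℝ≥0, a * (a / a) = a := fun a => by
    rcases eq_or_ne a 0 with rfl | h
    · simp
    · rw [div_self h, mul_one]
  rw [← mul_assoc, e, e, e, add_tsub_cancel_of_le hle]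

/-! ### Trajectories -/

/-- Trajectories `x_{0:s}`, that is, points of `X^{s+1}`. -/
abbrev Traj (X : Type*) (s : ℕ) := Fin (s + 1) → X

/-- The last state `x_s` of a trajectory `x_{0:s}`. -/
def Traj.last {X : Type*} {s : ℕ} (x : Traj X s) : X := x (Fin.last s)

/-- The initial segment `x_{0:s}` of a trajectory `x_{0:s+1}`. -/
def Traj.init {X : Type*} {s : ℕ} (x : Traj X (s + 1)) : Traj X s := fun k => x k.castSucc

/-- The trajectory `x_{0:s}` continued by the state `x_{s+1} = y`. -/
def Traj.extend {X : Type*} {s : ℕ} (x : Traj X s) (y : X) : Traj X (s + 1) :=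
  Fin.snoc (α := fun _ => X) x y

/-- The trajectory `x_{0:0}` with the single state `y`. -/
def Traj.single {X : Type*} (y : X) : Traj X 0 := fun _ => y

section Measurability

variable {X : Type*} [MeasurableSpace X] {s : ℕ}

@[fun_prop]
theorem Traj.measurable_last : Measurable (Traj.last : Traj X s → X) :=
  measurable_pi_apply _

@[fun_prop]
theorem Traj.measurable_init : Measurable (Traj.init : Traj X (s + 1) → Traj X s) :=
  measurable_pi_iff.2 fun _ => measurable_pi_apply _

@[fun_prop]
theorem Traj.measurable_extend :
    Measurable fun z : Traj X s × X => Traj.extend z.1 z.2 := by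
  refine measurable_pi_iff.2 fun k => ?_
  refine Fin.lastCases ?_ (fun k => ?_) k
  · simpa [Traj.extend] using measurable_snd
  · have h : Measurable fun z : Traj X s × X => z.1 k :=
      (measurable_pi_apply k).comp measurable_fst
    simpa only [Traj.extend, Fin.snoc_castSucc] using h

@[fun_prop]
theorem Traj.measurable_single : Measurable (Traj.single : X → Traj X 0) :=
  measurable_pi_iff.2 fun _ => measurable_id

end Measurability

/-! ### Resampling of trajectories as Markov kernels -/

section Resampling

variable {X : Type*} [MeasurableSpace X] {s : ℕ} (N : ℕ)

theorem measurable_probVector {A : Type*} [MeasurableSpace A] {N : ℕ} {w : A → Fin N → ℝ≥0}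
    (hw : ∀ i, Measurable fun a => w a i) (i : Fin N) :
    Measurable fun a => probVector (w a) i := by
  have h : Measurable fun a => ∑ j, w a j := Finset.measurable_sum _ fun j _ => hw j
  exact Measurable.ite (h (measurableSet_singleton 0)) measurable_const ((hw i).div h)

theorem measurable_coupledResampling {A : Type*} [MeasurableSpace A] {N : ℕ}
    {p q : A → Fin N → ℝ≥0} (hp : ∀ i, Measurable fun a => p a i)
    (hq : ∀ i, Measurable fun a => q a i) (i j : Fin N) :
    Measurable fun a => coupledResampling (p a) (q a) i j := by
  have ho : Measurable fun a => overlap (p a) (q a) :=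
    Finset.measurable_sum _ fun k _ => (hp k).min (hq k)
  unfold coupledResampling
  have h1 : Measurable fun a => if i = j then min (p a i) (q a i) / overlap (p a) (q a) else 0 := by
    split_ifs
    · exact ((hp i).min (hq i)).div ho
    · exact measurable_const
  have hr : Measurable fun a => 1 - overlap (p a) (q a) := measurable_const.sub ho
  exact (ho.mul h1).add (hr.mul ((((hp i).sub ((hp i).min (hq i))).div hr).mul
    (((hq j).sub ((hp j).min (hq j))).div hr)))

/-- Draw one of the `N` given trajectories with probability proportional to the weight `g` of its
last state. -/
def resampleKernel [NeZero N] (g : X → ℝ≥0) (hg : Measurable g) :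
    Kernel (Fin N → Traj X s) (Traj X s) where
  toFun ξ := ∑ i, (probVector (fun k => g (ξ k).last) i : ℝ≥0∞) • Measure.dirac (ξ i)
  measurable' := by
    refine Measure.measurable_of_measurable_coe _ fun B hB => ?_
    simp only [Measure.coe_finsetSum, Finset.sum_apply, Measure.smul_apply, smul_eq_mul]
    refine Finset.measurable_sum _ fun i _ => Measurable.mul ?_ ?_
    · exact (measurable_probVector (fun k => hg.comp (by fun_prop)) i).coe_nnreal_ennreal
    · exact (Measure.measurable_coe hB).comp (Measure.measurable_dirac.comp (by fun_prop))

instance [NeZero N] (g : X → ℝ≥0) (hg : Measurable g) :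
    IsMarkovKernel (resampleKernel (s := s) N g hg) := by
  refine ⟨fun ξ => ⟨?_⟩⟩
  change (∑ i, (probVector (fun k => g (ξ k).last) i : ℝ≥0∞) • Measure.dirac (ξ i)) Set.univ = 1
  simp only [Measure.coe_finsetSum, Finset.sum_apply, Measure.smul_apply, smul_eq_mul,
    measure_univ, mul_one]
  exact_mod_cast sum_probVector _

/-- Draw a pair of indices `(i, j)` by coupled resampling from the `N` given pairs of trajectories,
with the weights `g` of the last states of the first and of the second components, respectively;
return the first component of the `i`-th pair and the second component of the `j`-th pair. -/
def coupledResampleKernel [NeZero N] (g : X → ℝ≥0) (hg : Measurable g) :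
    Kernel (Fin N → Traj X s × Traj X s) (Traj X s × Traj X s) where
  toFun ξ := ∑ i, ∑ j, (coupledResampling (probVector fun k => g (ξ k).1.last)
    (probVector fun k => g (ξ k).2.last) i j : ℝ≥0∞) • Measure.dirac ((ξ i).1, (ξ j).2)
  measurable' := by
    refine Measure.measurable_of_measurable_coe _ fun B hB => ?_
    simp only [Measure.coe_finsetSum, Finset.sum_apply, Measure.smul_apply, smul_eq_mul]
    refine Finset.measurable_sum _ fun i _ => Finset.measurable_sum _ fun j _ =>
      Measurable.mul ?_ ?_
    · exact (measurable_coupledResampling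
        (fun i => measurable_probVector (fun k => hg.comp (by fun_prop)) i)
        (fun i => measurable_probVector (fun k => hg.comp (by fun_prop)) i) i j).coe_nnreal_ennreal
    · exact (Measure.measurable_coe hB).comp (Measure.measurable_dirac.comp (by fun_prop))

instance [NeZero N] (g : X → ℝ≥0) (hg : Measurable g) :
    IsMarkovKernel (coupledResampleKernel (s := s) N g hg) := by
  refine ⟨fun ξ => ⟨?_⟩⟩
  change (∑ i, ∑ j, (coupledResampling (probVector fun k => g (ξ k).1.last)
    (probVector fun k => g (ξ k).2.last) i j : ℝ≥0∞) • Measure.dirac ((ξ i).1, (ξ j).2))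
      Set.univ = 1
  simp only [Measure.coe_finsetSum, Finset.sum_apply, Measure.smul_apply, smul_eq_mul,
    measure_univ, mul_one]
  exact_mod_cast sum_coupledResampling _ _ (sum_probVector _) (sum_probVector _)

end Resampling

/-! ### The tempered target and the inner MCMC steps -/

/-- A Bayesian model on `X` (a prior, and the likelihood `x ↦ p(y ∣ x)` of the observed data, with
positive evidence so that the posterior is defined) together with `S` temperatures
`0 = α_0 < α_1 < ⋯ < α_S < 1`. Only the values `temp 0, …, temp S` matter. -/
structure TemperedTarget (X : Type*) [MeasurableSpace X] (S : ℕ) where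
  prior : Measure X
  isProbabilityMeasure_prior : IsProbabilityMeasure prior
  lik : X → ℝ≥0
  measurable_lik : Measurable lik
  evidence_pos : 0 < ∫⁻ x, (lik x : ℝ≥0∞) ∂prior
  temp : ℕ → ℝ
  temp_zero : temp 0 = 0
  temp_lt : ∀ s < S, temp s < temp (s + 1)
  temp_last : temp S < 1

attribute [instance] TemperedTarget.isProbabilityMeasure_prior

namespace TemperedTarget

variable {X : Type*} [MeasurableSpace X] {S : ℕ} (T : TemperedTarget X S)

/-- The tempered posterior `π_α(dx) ∝ p(y ∣ x)^α p(dx)`. -/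
def posterior (α : ℝ) : Measure X :=
  (∫⁻ x, ((T.lik x ^ α : ℝ≥0) : ℝ≥0∞) ∂T.prior)⁻¹ •
    T.prior.withDensity fun x => ((T.lik x ^ α : ℝ≥0) : ℝ≥0∞)

/-- The importance weight `p(y ∣ x)^(α_{s+1} - α_s)` of a state at stage `s < S`. -/
def weight (s : ℕ) (x : X) : ℝ≥0 := T.lik x ^ (T.temp (s + 1) - T.temp s)

/-- The final importance weight `p(y ∣ x)^(1 - α_S)`. -/
def finalWeight (x : X) : ℝ≥0 := T.lik x ^ (1 - T.temp S)

theorem measurable_weight (s : ℕ) : Measurable (T.weight s) :=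
  T.measurable_lik.pow_const _

theorem measurable_finalWeight : Measurable T.finalWeight :=
  T.measurable_lik.pow_const _

end TemperedTarget

/-- The inner MCMC steps: for `s = 1, …, S`, an MCMC kernel `kernel s` that leaves the tempered
posterior `π_{α_s}` invariant, the number `steps s` of times it is applied, and a faithful coupling
`coupling s` of two copies of it: a Markov kernel on pairs with marginals `kernel s` under which
equal states stay equal. Values at other indices `s` do not matter. -/
structure InnerMCMC {X : Type*} [MeasurableSpace X] {S : ℕ} (T : TemperedTarget X S) where
  steps : ℕ → ℕ
  kernel : ℕ → Kernel X X
  isMarkovKernel_kernel : ∀ s, IsMarkovKernel (kernel s)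
  invariant : ∀ s, 1 ≤ s → s ≤ S → (kernel s).Invariant (T.posterior (T.temp s))
  coupling : ℕ → Kernel (X × X) (X × X)
  isMarkovKernel_coupling : ∀ s, IsMarkovKernel (coupling s)
  map_fst : ∀ s, 1 ≤ s → s ≤ S → ∀ z, (coupling s z).map Prod.fst = kernel s z.1
  map_snd : ∀ s, 1 ≤ s → s ≤ S → ∀ z, (coupling s z).map Prod.snd = kernel s z.2
  faithful : ∀ s, 1 ≤ s → s ≤ S → ∀ x, ∀ᵐ z ∂coupling s (x, x), z.1 = z.2

attribute [instance] InnerMCMC.isMarkovKernel_kernel InnerMCMC.isMarkovKernel_coupling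

namespace InnerMCMC

variable {X : Type*} [MeasurableSpace X] {S : ℕ} {T : TemperedTarget X S} (K : InnerMCMC T)
  (N : ℕ) [NeZero N]

/-! ### The SMC sampler -/

/-- Continue a trajectory `x_{0:s}` by the state reached from `x_s` by the MCMC steps of stage
`s + 1`. -/
def move (s : ℕ) : Kernel (Traj X s) (Traj X (s + 1)) :=
  (Kernel.id ×ₖ (K.kernel (s + 1) ^ K.steps (s + 1)).comap Traj.last Traj.measurable_last).map
    fun z => Traj.extend z.1 z.2

instance (s : ℕ) : IsMarkovKernel (K.move s) :=
  Kernel.IsMarkovKernel.map _ (by fun_prop)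

/-- The law of the `N` particles of the SMC sampler at stage `s`, each with its ancestral
lineage. -/
def smcParticles : (s : ℕ) → Measure (Fin N → Traj X s)
  | 0 => Measure.pi fun _ => T.prior.map Traj.single
  | s + 1 => kernelPi (fun _ : Fin N =>
      K.move s ∘ₖ resampleKernel N (T.weight s) (T.measurable_weight s)) ∘ₘ smcParticles s

/-- The law of the trajectory that the SMC sampler returns: one draw from the final resampling
step, with its ancestral lineage. -/
def smc : Measure (Traj X S) :=
  resampleKernel N T.finalWeight T.measurable_finalWeight ∘ₘ K.smcParticles N S

instance (s : ℕ) : IsProbabilityMeasure (K.smcParticles N s) := by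
  induction s with
  | zero =>
    have : IsProbabilityMeasure (T.prior.map (Traj.single : X → Traj X 0)) :=
      Measure.isProbabilityMeasure_map (by fun_prop)
    unfold smcParticles; infer_instance
  | succ s ih => unfold smcParticles; infer_instance

instance : IsProbabilityMeasure (K.smc N) := by
  unfold smc; infer_instance

/-! ### Coupled conditional SMC -/

/-- Continue a pair of trajectories by the pair of states reached from their last states by the
coupled MCMC steps of stage `s + 1`. -/
def coupledMove (s : ℕ) : Kernel (Traj X s × Traj X s) (Traj X (s + 1) × Traj X (s + 1)) :=
  (Kernel.id ×ₖ (K.coupling (s + 1) ^ K.steps (s + 1)).comap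
      (fun z : Traj X s × Traj X s => (z.1.last, z.2.last)) (by fun_prop)).map
    fun w => (w.1.1.extend w.2.1, w.1.2.extend w.2.2)

instance (s : ℕ) : IsMarkovKernel (K.coupledMove s) :=
  Kernel.IsMarkovKernel.map _ (by fun_prop)

/-- Given the particle pairs at stage `s`, the law of a particle pair, other than the reference
pair, at stage `s + 1`: coupled resampling, then coupled MCMC steps. -/
def coupledStep (s : ℕ) :
    Kernel (Fin N → Traj X s × Traj X s) (Traj X (s + 1) × Traj X (s + 1)) :=
  K.coupledMove s ∘ₖ coupledResampleKernel N (T.weight s) (T.measurable_weight s)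

instance (s : ℕ) : IsMarkovKernel (K.coupledStep N s) := by
  unfold coupledStep; infer_instance

/-- At stage `0`, the first particle pair is the reference pair and each other pair consists of two
copies of an independent draw from the prior. -/
def initLaw (_K : InnerMCMC T) (i : Fin N) : Kernel (Traj X 0 × Traj X 0) (Traj X 0 × Traj X 0) :=
  if i = 0 then Kernel.id
  else Kernel.const _ (T.prior.map fun x => (Traj.single x, Traj.single x))

instance (i : Fin N) : IsMarkovKernel (K.initLaw N i) := by
  unfold initLaw
  split_ifs
  · infer_instance
  · have : IsProbabilityMeasure (T.prior.map fun x => (Traj.single x, Traj.single x)) :=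
      Measure.isProbabilityMeasure_map (by fun_prop)
    infer_instance

/-- At stage `s + 1`, given the reference pair and the particle pairs at stage `s`, the first
particle pair is the reference pair and the others are drawn from `coupledStep`. -/
def stepLaw (s : ℕ) (i : Fin N) :
    Kernel ((Traj X (s + 1) × Traj X (s + 1)) × (Fin N → Traj X s × Traj X s))
      (Traj X (s + 1) × Traj X (s + 1)) :=
  if i = 0 then Kernel.deterministic Prod.fst measurable_fst
  else (K.coupledStep N s).comap Prod.snd measurable_snd

instance (s : ℕ) (i : Fin N) : IsMarkovKernel (K.stepLaw N s i) := by
  unfold stepLaw; split_ifs <;> infer_instance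

/-- The law of the `N` pairs of particles of coupled conditional SMC at stage `s`, each with its
ancestral lineage, given the pair of reference trajectories `(x_{0:s}, x̄_{0:s})`. -/
def coupledParticles : (s : ℕ) → Kernel (Traj X s × Traj X s) (Fin N → Traj X s × Traj X s)
  | 0 => kernelPi (K.initLaw N)
  | s + 1 => kernelPi (K.stepLaw N s) ∘ₖ
      (Kernel.id ×ₖ (coupledParticles s).comap
        (fun z : Traj X (s + 1) × Traj X (s + 1) => (z.1.init, z.2.init)) (by fun_prop))

instance (s : ℕ) : IsMarkovKernel (K.coupledParticles N s) := by
  induction s with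
  | zero => unfold coupledParticles; infer_instance
  | succ s ih => unfold coupledParticles; infer_instance

/-- The coupled conditional SMC step with `N` particles, as a Markov kernel on pairs of
trajectories. -/
def coupledCSMC : Kernel (Traj X S × Traj X S) (Traj X S × Traj X S) :=
  coupledResampleKernel N T.finalWeight T.measurable_finalWeight ∘ₖ K.coupledParticles N S

instance : IsMarkovKernel (K.coupledCSMC N) := by
  unfold coupledCSMC; infer_instance

/-- The conditional SMC step for a single chain: the first component of coupled conditional SMC
started from two copies of the current trajectory. -/
def csmc : Kernel (Traj X S) (Traj X S) :=
  ((K.coupledCSMC N).comap (fun x => (x, x)) (by fun_prop)).map Prod.fst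

instance : IsMarkovKernel (K.csmc N) :=
  Kernel.IsMarkovKernel.map _ measurable_fst

/-! ### Coupled particle MCMC using conditional SMC only -/

/-- The law of `(x_{0:S}(t), x̄_{0:S}(t))`, `t = 1, 2, …`, when the pair at time `1` has law `μ` and
the later pairs are produced by coupled conditional SMC steps. Time `t` is stored at index
`t - 1`. -/
def chainLaw (μ : Measure (Traj X S × Traj X S)) : Measure (ℕ → Traj X S × Traj X S) :=
  Kernel.trajMeasure (X := fun _ => Traj X S × Traj X S) μ fun n =>
    (K.coupledCSMC N).comap (fun h => h ⟨n, Finset.mem_Iic.2 le_rfl⟩) (by fun_prop)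

/-- The initialization of coupled particle MCMC: draw `x_{0:S}(0)` by SMC, draw `x_{0:S}(1)` given
`x_{0:S}(0)` by conditional SMC, and set `x̄_{0:S}(1) = x_{0:S}(0)`. This is the law of
`(x_{0:S}(1), x̄_{0:S}(1))`. -/
def initialPair : Measure (Traj X S × Traj X S) :=
  (K.smc N ⊗ₘ K.csmc N).map Prod.swap

instance : IsProbabilityMeasure (K.initialPair N) :=
  Measure.isProbabilityMeasure_map (by fun_prop)

end InnerMCMC

/-- The meeting time `τ = inf {t ≥ 1 ∣ x_{0:S}(t) = x̄_{0:S}(t)}` of a sequence of pairs whose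
`n`-th entry, `n = 0, 1, …`, is the pair at time `n + 1`; it is `∞` if the chains never meet. -/
def meetingTime {E : Type*} (ω : ℕ → E × E) : ℝ≥0∞ :=
  ⨅ (n : ℕ) (_ : (ω n).1 = (ω n).2), ((n + 1 : ℕ) : ℝ≥0∞)

end

noncomputable section

/-! ### A lower deviation bound for sums of independent variables -/

/-! Call a particle pair coupled when its two lineages agree. A coupled pair carries the same weight
in both systems, and by faithfulness its inner moves are those of a single chain. It remains to show
that coupled pairs carry almost all the weight, uniformly in the reference pair.

Lower bound on coupled weight. For a test function `h` with values in [0, 1], a free pair at stage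
s+1 has conditional coupled mean of `h` at least `coupledSum (pullback h) / N`, since no total
weight exceeds `N * M`. Invariance of the tempered posterior keeps the integral of `pullback h`
against the stage-s density positive, so one can descend to stage 0, where all free pairs are
coupled. Conditional independence and an exponential Markov bound make the coupled sum of order N
outside an event of probability O(1/N) (`exists_coupledParticles_coupledSum_lt_le`).

Few uncoupled pairs. With coupled weight A and V uncoupled pairs, resampling fails to couple with
probability at most b/(A+b), where b = M(1+V). Once A is of order N and E(V) is bounded this is
O(1/N), so the next stage again has a bounded expected number of uncoupled pairs
(`exists_lintegral_uncoupledCount_le`). The final draw then fails with probability at most c/N.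

That bound is void for N ≤ c, so the same descent with expectations supplies a success probability
at least δ > 0 for all N ≥ 2. Both bounds together give N/(N + c/δ), and a geometric tail estimate
handles the meeting time. -/

theorem ofReal_exp_neg_add_half_le_one {a : ℝ≥0∞} (ha : a ≤ 1) :
    ENNReal.ofReal (Real.exp (-a.toReal)) + a / 2 ≤ 1 := by
  have hfin : a ≠ ∞ := ne_top_of_le_ne_top ENNReal.one_ne_top ha
  obtain ⟨x, rfl⟩ : ∃ x : ℝ≥0, a = x := ⟨a.toNNReal, (ENNReal.coe_toNNReal hfin).symm⟩
  have hx : (x : ℝ) ≤ 1 := by exact_mod_cast ha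
  have hx0 : (0 : ℝ) ≤ x := x.2
  -- On [0, 1], (1 - x/2)(1 + x) = 1 + x(1 - x)/2 ≥ 1, so 1/(1 + x) ≤ 1 - x/2.
  have h1 : Real.exp (-(x : ℝ)) ≤ 1 - x / 2 := by
    have h2 : 1 + (x : ℝ) ≤ Real.exp x := by linarith [Real.add_one_le_exp (x : ℝ)]
    rw [Real.exp_neg]
    calc (Real.exp x)⁻¹ ≤ (1 + (x : ℝ))⁻¹ := by gcongr
      _ ≤ 1 - x / 2 := by
        rw [inv_le_iff_one_le_mul₀ (by positivity)]
        nlinarith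
  have h3 : (x : ℝ≥0∞) / 2 = ENNReal.ofReal ((x : ℝ) / 2) := by
    rw [ENNReal.ofReal_div_of_pos (by norm_num), ENNReal.ofReal_coe_nnreal]
    norm_num
  rw [ENNReal.coe_toReal, h3, ← ENNReal.ofReal_add (Real.exp_nonneg _) (by positivity)]
  exact ENNReal.ofReal_le_one.2 (by linarith)

theorem lintegral_pi_prod {ι E : Type*} [Fintype ι] [MeasurableSpace E] (μ : ι → Measure E)
    [∀ i, IsProbabilityMeasure (μ i)] {g : ι → E → ℝ≥0∞} (hg : ∀ i, Measurable (g i)) :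
    ∫⁻ x, ∏ i, g i (x i) ∂Measure.pi μ = ∏ i, ∫⁻ y, g i y ∂μ i := by
  have h := lintegral_prod_eq_prod_lintegral_of_indepFun (μ := Measure.pi μ) Finset.univ
    (fun i (x : ι → E) => g i (x i))
    ((iIndepFun_pi (μ := μ) (X := fun i => g i) fun i => (hg i).aemeasurable))
    (fun i => (hg i).comp (measurable_pi_apply i))
  rw [h]
  refine Finset.prod_congr rfl fun i _ => ?_
  exact (measurePreserving_eval μ i).lintegral_comp (hg i)

/-- If `f i` has values in `[0, 1]` and mean at least `q` for `i ∈ I`, the sum over `i ∈ I` of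
independent copies is unlikely to be below a quarter of its expectation. -/
theorem measure_pi_sum_lt_le {ι E : Type*} [Fintype ι] [MeasurableSpace E] (μ : ι → Measure E)
    [∀ i, IsProbabilityMeasure (μ i)] (I : Finset ι) {f : E → ℝ≥0∞} (hf : Measurable f)
    (hf1 : ∀ x, f x ≤ 1) {q : ℝ} (hq0 : 0 ≤ q) (hq : ∀ i ∈ I, ENNReal.ofReal q ≤ ∫⁻ x, f x ∂μ i) :
    Measure.pi μ {x | ∑ i ∈ I, f (x i) < ENNReal.ofReal (I.card * q / 4)} ≤
      ENNReal.ofReal (Real.exp (-(I.card * q / 4))) := by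
  classical
  -- Markov's inequality for exp(-Σ f): each factor has mean at most 1 - q/2 ≤ exp(-q/2), so the
  -- product is at most exp(-2t). The threshold t costs exp(t), leaving exp(-t).
  set t : ℝ := I.card * q / 4 with ht
  set g : ι → E → ℝ≥0∞ := fun i x =>
    if i ∈ I then ENNReal.ofReal (Real.exp (-(f x).toReal)) else 1 with hg
  have hgm : ∀ i, Measurable (g i) := by
    intro i
    simp only [hg]
    split_ifs
    · fun_prop
    · exact measurable_const
  have hprod : ∀ x : ι → E, ∏ i, g i (x i) =
      ENNReal.ofReal (Real.exp (-(∑ i ∈ I, f (x i)).toReal)) := by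
    intro x
    have hfin : ∀ i ∈ I, f (x i) ≠ ∞ := fun i _ =>
      ne_top_of_le_ne_top ENNReal.one_ne_top (hf1 _)
    simp only [hg]
    rw [Finset.prod_ite_mem, Finset.univ_inter, ENNReal.toReal_sum hfin,
      ← Finset.sum_neg_distrib, Real.exp_sum,
      ENNReal.ofReal_prod_of_nonneg fun i _ => Real.exp_nonneg _]
  have hmark : ∀ x : ι → E, Set.indicator {x | ∑ i ∈ I, f (x i) < ENNReal.ofReal t} 1 x ≤
      ENNReal.ofReal (Real.exp t) * ∏ i, g i (x i) := by
    intro x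
    by_cases hx : ∑ i ∈ I, f (x i) < ENNReal.ofReal t
    · rw [Set.indicator_of_mem (by exact hx), hprod, ← ENNReal.ofReal_mul (Real.exp_nonneg _),
        ← Real.exp_add]
      refine ENNReal.one_le_ofReal.2 (Real.one_le_exp ?_)
      have := ENNReal.toReal_le_of_le_ofReal (by positivity) hx.le
      linarith
    · rw [Set.indicator_of_notMem (by exact hx)]
      exact zero_le
  have hS : MeasurableSet {x : ι → E | ∑ i ∈ I, f (x i) < ENNReal.ofReal t} :=
    measurableSet_lt (by fun_prop) measurable_const
  have hone : ∀ i ∈ I, ∫⁻ y, g i y ∂μ i ≤ ENNReal.ofReal (Real.exp (-(q / 2))) := by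
    intro i hi
    have h1 : ∫⁻ y, g i y ∂μ i + ENNReal.ofReal (q / 2) ≤ 1 := by
      have h2 : ENNReal.ofReal (q / 2) ≤ ∫⁻ y, f y / 2 ∂μ i := by
        simp only [div_eq_mul_inv]
        rw [lintegral_mul_const _ hf, ← div_eq_mul_inv, ← div_eq_mul_inv,
          ENNReal.ofReal_div_of_pos (by norm_num), ENNReal.ofReal_ofNat]
        gcongr
        exact hq i hi
      calc ∫⁻ y, g i y ∂μ i + ENNReal.ofReal (q / 2)
          ≤ ∫⁻ y, g i y ∂μ i + ∫⁻ y, f y / 2 ∂μ i := by gcongr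
        _ = ∫⁻ y, g i y + f y / 2 ∂μ i := (lintegral_add_left (hgm i) _).symm
        _ ≤ ∫⁻ y, 1 ∂μ i := by
          refine lintegral_mono fun y => ?_
          simp only [hg, if_pos hi]
          exact ofReal_exp_neg_add_half_le_one (hf1 y)
        _ = 1 := by simp
    calc ∫⁻ y, g i y ∂μ i ≤ 1 - ENNReal.ofReal (q / 2) :=
          ENNReal.le_sub_of_add_le_right ENNReal.ofReal_ne_top h1
      _ = ENNReal.ofReal (1 - q / 2) := by
          rw [ENNReal.ofReal_sub _ (by positivity), ENNReal.ofReal_one]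
      _ ≤ _ := ENNReal.ofReal_le_ofReal (by linarith [Real.add_one_le_exp (-(q / 2))])
  have hother : ∀ i ∉ I, ∫⁻ y, g i y ∂μ i = 1 := by
    intro i hi
    simp [hg, hi]
  calc Measure.pi μ {x | ∑ i ∈ I, f (x i) < ENNReal.ofReal t}
      = ∫⁻ x, Set.indicator {x | ∑ i ∈ I, f (x i) < ENNReal.ofReal t} 1 x ∂Measure.pi μ :=
        (lintegral_indicator_one hS).symm
    _ ≤ ∫⁻ x, ENNReal.ofReal (Real.exp t) * ∏ i, g i (x i) ∂Measure.pi μ := lintegral_mono hmark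
    _ = ENNReal.ofReal (Real.exp t) * ∏ i, ∫⁻ y, g i y ∂μ i := by
      rw [lintegral_const_mul' _ _ ENNReal.ofReal_ne_top, lintegral_pi_prod μ hgm]
    _ = ENNReal.ofReal (Real.exp t) * ∏ i ∈ I, ∫⁻ y, g i y ∂μ i := by
      rw [Finset.prod_subset (Finset.subset_univ I) fun i _ hi => hother i hi]
    _ ≤ ENNReal.ofReal (Real.exp t) * ∏ i ∈ I, ENNReal.ofReal (Real.exp (-(q / 2))) := by
      gcongr with i hi
      exact hone i hi
    _ = ENNReal.ofReal (Real.exp (-t)) := by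
      rw [Finset.prod_const, ← ENNReal.ofReal_pow (Real.exp_nonneg _), ← Real.exp_nat_mul,
        ← ENNReal.ofReal_mul (Real.exp_nonneg _), ← Real.exp_add]
      congr 2
      rw [ht]; ring

/-! ### Weights of coupled resampling -/

/-- Enlarging the normalizer only lowers the value. If all weights vanish the left side is 0, so the
uniform convention is harmless. -/
theorem div_le_probVector {N : ℕ} (w : Fin N → ℝ≥0) {B : ℝ≥0} (hB : ∑ j, w j ≤ B) (i : Fin N) :
    w i / B ≤ probVector w i := by
  unfold probVector
  split_ifs with h
  · rw [(Finset.sum_eq_zero_iff.1 h) i (Finset.mem_univ i), zero_div]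
    exact zero_le
  · gcongr

/-- The common-index branch alone contributes the minimum; the residual branch is dropped. -/
theorem min_le_coupledResampling {N : ℕ} (p q : Fin N → ℝ≥0) (i : Fin N) :
    min (p i) (q i) ≤ coupledResampling p q i i := by
  unfold coupledResampling
  refine le_trans ?_ le_self_add
  rw [if_pos rfl]
  by_cases h : overlap p q = 0
  · rw [(Finset.sum_eq_zero_iff.1 h) i (Finset.mem_univ i)]
    exact zero_le
  · rw [mul_div_cancel₀ _ h]

/-! ### Coupled particles -/

section CoupledParticles

variable {X : Type*} {s : ℕ}

/-- The function `(x, x̄) ↦ 1{x = x̄} h(x_s)` of a pair of trajectories `x_{0:s}`, `x̄_{0:s}`. -/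
def coupledFun (h : X → ℝ≥0∞) : Traj X s × Traj X s → ℝ≥0∞ :=
  Set.indicator {w | w.1 = w.2} fun w => h w.1.last

/-- The sum of `h` over the last states of the coupled particles other than the first one. -/
def coupledSum {N : ℕ} [NeZero N] (h : X → ℝ≥0∞) (ξ : Fin N → Traj X s × Traj X s) : ℝ≥0∞ :=
  ∑ i ∈ Finset.univ.erase 0, coupledFun h (ξ i)

/-- The number of particle pairs whose components differ. -/
def uncoupledCount {N : ℕ} (ξ : Fin N → Traj X s × Traj X s) : ℝ≥0∞ :=
  ∑ i, Set.indicator {w : Traj X s × Traj X s | w.1 = w.2}ᶜ 1 (ξ i)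

theorem coupledFun_diag (h : X → ℝ≥0∞) (x : Traj X s) : coupledFun h (x, x) = h x.last :=
  Set.indicator_of_mem (s := {w : Traj X s × Traj X s | w.1 = w.2}) rfl _

theorem coupledFun_of_eq (h : X → ℝ≥0∞) {w : Traj X s × Traj X s} (hw : w.1 = w.2) :
    coupledFun h w = h w.1.last :=
  Set.indicator_of_mem (s := {w : Traj X s × Traj X s | w.1 = w.2}) hw _

theorem coupledFun_of_ne (h : X → ℝ≥0∞) {w : Traj X s × Traj X s} (hw : w.1 ≠ w.2) :
    coupledFun h w = 0 :=
  Set.indicator_of_notMem (s := {w : Traj X s × Traj X s | w.1 = w.2}) hw _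

theorem coupledFun_le {h : X → ℝ≥0∞} {M : ℝ≥0∞} (hM : ∀ x, h x ≤ M) (w : Traj X s × Traj X s) :
    coupledFun h w ≤ M :=
  (Set.indicator_le_self _ _ w).trans (hM _)

theorem coupledFun_one :
    coupledFun (1 : X → ℝ≥0∞) = Set.indicator {w : Traj X s × Traj X s | w.1 = w.2} 1 := rfl

theorem coupledFun_const_mul (a : ℝ≥0∞) (h : X → ℝ≥0∞) (w : Traj X s × Traj X s) :
    coupledFun (fun x => a * h x) w = a * coupledFun h w := by
  by_cases hw : w.1 = w.2
  · simp only [coupledFun_of_eq _ hw]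
  · simp only [coupledFun_of_ne _ hw, mul_zero]

theorem coupledSum_const_mul {N : ℕ} [NeZero N] (a : ℝ≥0∞) (h : X → ℝ≥0∞)
    (ξ : Fin N → Traj X s × Traj X s) :
    coupledSum (fun x => a * h x) ξ = a * coupledSum h ξ := by
  simp only [coupledSum, coupledFun_const_mul, Finset.mul_sum]

theorem uncoupledCount_le {N : ℕ} (ξ : Fin N → Traj X s × Traj X s) : uncoupledCount ξ ≤ N := by
  calc uncoupledCount ξ ≤ ∑ _i : Fin N, 1 :=
        Finset.sum_le_sum fun i _ => Set.indicator_le_self _ _ _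
    _ = N := by simp

theorem coupledSum_ne_top {N : ℕ} [NeZero N] {h : X → ℝ≥0∞} (hh : ∀ x, h x ≠ ∞)
    (ξ : Fin N → Traj X s × Traj X s) : coupledSum h ξ ≠ ∞ := by
  refine ENNReal.sum_ne_top.2 fun i _ => ?_
  by_cases hw : (ξ i).1 = (ξ i).2
  · rw [coupledFun_of_eq _ hw]; exact hh _
  · simp [coupledFun_of_ne _ hw]

/-- The total weight of either system is at most the weight of its coupled particles plus the
maximal weight of the other ones. -/
theorem sum_weight_le {N : ℕ} [NeZero N] {g : X → ℝ≥0} {M : ℝ≥0} (hM : ∀ x, g x ≤ M)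
    (ξ : Fin N → Traj X s × Traj X s) (π : Traj X s × Traj X s → Traj X s)
    (hπ : ∀ w, w.1 = w.2 → π w = w.1) :
    ((∑ i, g (π (ξ i)).last : ℝ≥0) : ℝ≥0∞) ≤
      coupledSum (fun x => (g x : ℝ≥0∞)) ξ + M * (1 + uncoupledCount ξ) := by
  have hle : ∀ i, (g (π (ξ i)).last : ℝ≥0∞) ≤ coupledFun (fun x => (g x : ℝ≥0∞)) (ξ i) +
      M * Set.indicator {w : Traj X s × Traj X s | w.1 = w.2}ᶜ 1 (ξ i) := by
    intro i
    by_cases hw : (ξ i).1 = (ξ i).2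
    · rw [coupledFun_of_eq _ hw, hπ _ hw]
      exact le_self_add
    · have h1 : Set.indicator {w : Traj X s × Traj X s | w.1 = w.2}ᶜ (1 : Traj X s × Traj X s → ℝ≥0∞) (ξ i) = 1 :=
        Set.indicator_of_mem (s := {w : Traj X s × Traj X s | w.1 = w.2}ᶜ) hw _
      rw [h1, mul_one]
      exact le_add_left (by exact_mod_cast hM _)
  rw [ENNReal.ofNNReal_finsetSum, ← Finset.add_sum_erase _ _ (Finset.mem_univ (0 : Fin N))]
  calc (g (π (ξ 0)).last : ℝ≥0∞) + ∑ i ∈ Finset.univ.erase 0, (g (π (ξ i)).last : ℝ≥0∞)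
      ≤ M + ∑ i ∈ Finset.univ.erase 0, (coupledFun (fun x => (g x : ℝ≥0∞)) (ξ i) +
          M * Set.indicator {w : Traj X s × Traj X s | w.1 = w.2}ᶜ 1 (ξ i)) := by
        gcongr with i _
        · exact hM _
        · exact hle i
    -- Index 0 is outside `coupledSum`, hence the extra M. An uncoupled reference pair is thereby
    -- counted twice, which does no harm.
    _ ≤ M + (coupledSum (fun x => (g x : ℝ≥0∞)) ξ + M * uncoupledCount ξ) := by
        rw [Finset.sum_add_distrib, ← Finset.mul_sum]
        gcongr
        · rfl
        · exact Finset.sum_le_sum_of_subset (Finset.erase_subset _ _)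
    _ = _ := by ring

theorem sum_weight_le_mul {N : ℕ} {E : Type*} {g : E → ℝ≥0} {M : ℝ≥0} (hM : ∀ x, g x ≤ M)
    (x : Fin N → E) : ∑ i, g (x i) ≤ N * M := by
  calc ∑ i, g (x i) ≤ ∑ _i : Fin N, M := Finset.sum_le_sum fun i _ => hM _
    _ = N * M := by simp

variable [MeasurableSpace X]

theorem measurableSet_traj_eq [MeasurableEq X] :
    MeasurableSet {w : Traj X s × Traj X s | w.1 = w.2} := by
  have h : {w : Traj X s × Traj X s | w.1 = w.2} = ⋂ k, {w | w.1 k = w.2 k} := by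
    ext w; simp [funext_iff]
  rw [h]
  exact MeasurableSet.iInter fun k => measurableSet_eq_fun (by fun_prop) (by fun_prop)

theorem measurable_coupledFun [MeasurableEq X] {h : X → ℝ≥0∞} (hh : Measurable h) :
    Measurable (coupledFun h : Traj X s × Traj X s → ℝ≥0∞) :=
  (hh.comp (by fun_prop)).indicator measurableSet_traj_eq

theorem measurable_coupledSum [MeasurableEq X] {N : ℕ} [NeZero N] {h : X → ℝ≥0∞}
    (hh : Measurable h) :
    Measurable (coupledSum h : (Fin N → Traj X s × Traj X s) → ℝ≥0∞) :=
  Finset.measurable_sum _ fun i _ => (measurable_coupledFun hh).comp (measurable_pi_apply i)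

theorem measurable_uncoupledCount [MeasurableEq X] {N : ℕ} :
    Measurable (uncoupledCount : (Fin N → Traj X s × Traj X s) → ℝ≥0∞) :=
  Finset.measurable_sum _ fun i _ =>
    (measurable_one.indicator measurableSet_traj_eq.compl).comp (measurable_pi_apply i)

theorem lintegral_coupledResampleKernel {N : ℕ} [NeZero N] {g : X → ℝ≥0} (hg : Measurable g)
    (ξ : Fin N → Traj X s × Traj X s) {F : Traj X s × Traj X s → ℝ≥0∞} (hF : Measurable F) :
    ∫⁻ w, F w ∂coupledResampleKernel N g hg ξ = ∑ i, ∑ j,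
      (coupledResampling (probVector fun k => g (ξ k).1.last)
        (probVector fun k => g (ξ k).2.last) i j : ℝ≥0∞) * F ((ξ i).1, (ξ j).2) := by
  change ∫⁻ w, F w ∂(∑ i, ∑ j, (coupledResampling (probVector fun k => g (ξ k).1.last)
    (probVector fun k => g (ξ k).2.last) i j : ℝ≥0∞) • Measure.dirac ((ξ i).1, (ξ j).2)) = _
  simp only [lintegral_finsetSum_measure, lintegral_smul_measure, smul_eq_mul,
    lintegral_dirac' _ hF]

/-- Only draws with equal indices at a coupled free pair are kept. Such a pair has the same weight
in both systems, so both probabilities, and hence their minimum, are at least that weight over a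
common bound `B` of the totals. -/
theorem sum_div_le_lintegral_coupledResampleKernel {N : ℕ} [NeZero N] {g : X → ℝ≥0}
    (hg : Measurable g) (ξ : Fin N → Traj X s × Traj X s) {F : Traj X s × Traj X s → ℝ≥0∞}
    (hF : Measurable F) {B : ℝ≥0} (hB0 : B ≠ 0) (hB1 : ∑ i, g (ξ i).1.last ≤ B)
    (hB2 : ∑ i, g (ξ i).2.last ≤ B) :
    (∑ i ∈ Finset.univ.erase 0, Set.indicator {w | w.1 = w.2}
        (fun w => (g w.1.last : ℝ≥0∞) * F w) (ξ i)) / B ≤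
      ∫⁻ w, F w ∂coupledResampleKernel N g hg ξ := by
  rw [lintegral_coupledResampleKernel hg ξ hF, ENNReal.div_eq_inv_mul, Finset.mul_sum]
  refine (Finset.sum_le_sum_of_subset (Finset.erase_subset _ _)).trans
    (Finset.sum_le_sum fun i _ => ?_)
  by_cases hw : (ξ i).1 = (ξ i).2
  · rw [Set.indicator_of_mem (by exact hw)]
    refine le_trans ?_ (Finset.single_le_sum (fun _ _ => zero_le) (Finset.mem_univ i))
    rw [← mul_assoc]
    gcongr
    refine le_trans ?_ (ENNReal.coe_le_coe.2 (min_le_coupledResampling _ _ i))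
    rw [← ENNReal.coe_inv hB0, ← ENNReal.coe_mul, ENNReal.coe_le_coe, mul_comm, ← div_eq_mul_inv]
    refine le_min (div_le_probVector _ hB1 i) ?_
    have := div_le_probVector (fun k => g (ξ k).2.last) hB2 i
    rwa [← hw] at this
  · rw [Set.indicator_of_notMem (by exact hw), mul_zero]
    exact zero_le

/-- The probability that coupled resampling returns a coupled pair. -/
theorem coupledSum_div_le_coupledResampleKernel [MeasurableEq X] {N : ℕ} [NeZero N] {g : X → ℝ≥0}
    (hg : Measurable g) (ξ : Fin N → Traj X s × Traj X s) {B : ℝ≥0} (hB0 : B ≠ 0)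
    (hB1 : ∑ i, g (ξ i).1.last ≤ B) (hB2 : ∑ i, g (ξ i).2.last ≤ B) :
    coupledSum (fun x => (g x : ℝ≥0∞)) ξ / B ≤
      coupledResampleKernel N g hg ξ {w | w.1 = w.2} := by
  have h := sum_div_le_lintegral_coupledResampleKernel hg ξ
    (measurable_coupledFun (s := s) (measurable_one (α := ℝ≥0∞) (β := X))) hB0 hB1 hB2
  rw [coupledFun_one, lintegral_indicator_one measurableSet_traj_eq] at h
  refine le_trans (le_of_eq ?_) h
  congr 1
  refine Finset.sum_congr rfl fun i _ => ?_
  by_cases hw : (ξ i).1 = (ξ i).2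
  · rw [coupledFun_of_eq _ hw, Set.indicator_of_mem (by exact hw),
      Set.indicator_of_mem (by exact hw), Pi.one_apply, mul_one]
  · rw [coupledFun_of_ne _ hw, Set.indicator_of_notMem (by exact hw)]

/-- The probability that coupled resampling does not return a coupled pair. -/
theorem coupledResampleKernel_compl_le [MeasurableEq X] {N : ℕ} [NeZero N] {g : X → ℝ≥0}
    (hg : Measurable g) {M : ℝ≥0} (hM : ∀ x, g x ≤ M) {a : ℝ≥0∞} (ha : a ≠ 0)
    (ξ : Fin N → Traj X s × Traj X s) :
    coupledResampleKernel N g hg ξ {w | w.1 = w.2}ᶜ ≤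
      Set.indicator {ξ | coupledSum (fun x => (g x : ℝ≥0∞)) ξ < a} 1 ξ +
        M * (1 + uncoupledCount ξ) / a := by
  set A := coupledSum (fun x => (g x : ℝ≥0∞)) ξ with hA
  set b : ℝ≥0∞ := M * (1 + uncoupledCount ξ) with hb
  by_cases hlt : A < a
  · rw [Set.indicator_of_mem (by exact hlt)]
    exact prob_le_one.trans le_self_add
  rw [Set.indicator_of_notMem (by exact hlt), zero_add]
  have haA : a ≤ A := not_lt.1 hlt
  have hA0 : A ≠ 0 := fun h => ha (le_antisymm (h ▸ haA) zero_le)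
  have hAtop : A ≠ ∞ := coupledSum_ne_top (fun x => ENNReal.coe_ne_top) ξ
  have hbtop : b ≠ ∞ := by
    refine ENNReal.mul_ne_top ENNReal.coe_ne_top (ENNReal.add_ne_top.2 ⟨ENNReal.one_ne_top, ?_⟩)
    exact ne_top_of_le_ne_top (ENNReal.natCast_ne_top N) (uncoupledCount_le ξ)
  -- A + b bounds the total weight of both systems, so coupling succeeds with probability at least
  -- A/(A + b).
  obtain ⟨B, hB⟩ : ∃ B : ℝ≥0, (B : ℝ≥0∞) = A + b :=
    ⟨(A + b).toNNReal, ENNReal.coe_toNNReal (ENNReal.add_ne_top.2 ⟨hAtop, hbtop⟩)⟩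
  have hAB0 : A + b ≠ 0 := by simp [hA0]
  have hB0 : B ≠ 0 := by
    rintro rfl
    exact hAB0 (by rw [← hB, ENNReal.coe_zero])
  have h1 : ∑ i, g (ξ i).1.last ≤ B := by
    rw [← ENNReal.coe_le_coe, hB]
    exact sum_weight_le hM ξ Prod.fst fun w _ => rfl
  have h2 : ∑ i, g (ξ i).2.last ≤ B := by
    rw [← ENNReal.coe_le_coe, hB]
    exact sum_weight_le hM ξ Prod.snd fun w hw => hw.symm
  have hle := coupledSum_div_le_coupledResampleKernel hg ξ hB0 h1 h2
  rw [hB] at hle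
  rw [prob_compl_eq_one_sub measurableSet_traj_eq]
  calc 1 - coupledResampleKernel N g hg ξ {w | w.1 = w.2}
      ≤ 1 - A / (A + b) := by gcongr
    _ = b / (A + b) := by
      refine ENNReal.sub_eq_of_eq_add_rev
        (ENNReal.div_ne_top hAtop hAB0) ?_
      rw [← ENNReal.add_div, ENNReal.div_self hAB0 (ENNReal.add_ne_top.2 ⟨hAtop, hbtop⟩)]
    _ ≤ b / a := by
      gcongr
      exact haA.trans le_self_add

end CoupledParticles

/-! ### Tempered posteriors -/

namespace TemperedTarget

variable {X : Type*} [MeasurableSpace X] {S : ℕ} (T : TemperedTarget X S)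

theorem temp_nonneg {s : ℕ} (hs : s ≤ S) : 0 ≤ T.temp s := by
  induction s with
  | zero => exact T.temp_zero.ge
  | succ s ih => exact (ih (by omega)).trans (T.temp_lt s hs).le

/-- The unnormalized density `p(y ∣ x)^α` of the tempered posterior. -/
def density (α : ℝ) (x : X) : ℝ≥0∞ := ((T.lik x ^ α : ℝ≥0) : ℝ≥0∞)

theorem measurable_density (α : ℝ) : Measurable (T.density α) :=
  (T.measurable_lik.pow_const α).coe_nnreal_ennreal

theorem density_zero : T.density (T.temp 0) = 1 := by
  ext x
  simp [density, T.temp_zero]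

theorem density_mul {α β : ℝ} (hα : 0 ≤ α) (hβ : 0 ≤ β) (x : X) :
    T.density α x * ((T.lik x ^ β : ℝ≥0) : ℝ≥0∞) = T.density (α + β) x := by
  rw [density, density, ← ENNReal.coe_mul, NNReal.rpow_add_of_nonneg _ hα hβ]

theorem density_mul_weight {s : ℕ} (hs : s < S) (x : X) :
    T.density (T.temp s) x * (T.weight s x : ℝ≥0∞) = T.density (T.temp (s + 1)) x := by
  rw [weight, T.density_mul (T.temp_nonneg hs.le) (sub_nonneg.2 (T.temp_lt s hs).le),
    add_sub_cancel]

theorem density_mul_finalWeight (x : X) :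
    T.density (T.temp S) x * (T.finalWeight x : ℝ≥0∞) = T.lik x := by
  rw [finalWeight, T.density_mul (T.temp_nonneg le_rfl) (sub_nonneg.2 T.temp_last.le),
    add_sub_cancel, density, NNReal.rpow_one]

/-- A power of the likelihood can vanish only where the likelihood does, so a zero integral would
contradict positive evidence. -/
theorem lintegral_density_ne_zero (α : ℝ) : ∫⁻ x, T.density α x ∂T.prior ≠ 0 := by
  intro h
  rw [lintegral_eq_zero_iff (T.measurable_density α)] at h
  refine T.evidence_pos.ne' ?_
  rw [lintegral_eq_zero_iff T.measurable_lik.coe_nnreal_ennreal]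
  filter_upwards [h] with x hx
  have h1 : T.lik x ^ α = 0 := by simpa [density] using hx
  have h2 := (NNReal.rpow_eq_zero_iff.1 h1).1
  simp [h2]

variable {T}

theorem exists_rpow_lik_le (hL : BddAbove (Set.range T.lik)) {β : ℝ} (hβ : 0 ≤ β) :
    ∃ M : ℝ≥0, M ≠ 0 ∧ ∀ x, T.lik x ^ β ≤ M := by
  obtain ⟨L, hL⟩ := hL
  -- The added 1 keeps the bound nonzero, so that weights can be divided by it.
  refine ⟨L ^ β + 1, by positivity, fun x => le_trans ?_ le_self_add⟩
  exact NNReal.rpow_le_rpow (hL ⟨x, rfl⟩) hβ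

theorem exists_weight_le (hL : BddAbove (Set.range T.lik)) {s : ℕ} (hs : s < S) :
    ∃ M : ℝ≥0, M ≠ 0 ∧ ∀ x, T.weight s x ≤ M :=
  exists_rpow_lik_le hL (sub_nonneg.2 (T.temp_lt s hs).le)

theorem exists_finalWeight_le (hL : BddAbove (Set.range T.lik)) :
    ∃ M : ℝ≥0, M ≠ 0 ∧ ∀ x, T.finalWeight x ≤ M :=
  exists_rpow_lik_le hL (sub_nonneg.2 T.temp_last.le)

theorem lintegral_density_ne_top (hL : BddAbove (Set.range T.lik)) {α : ℝ} (hα : 0 ≤ α) :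
    ∫⁻ x, T.density α x ∂T.prior ≠ ∞ := by
  obtain ⟨M, -, hM⟩ := exists_rpow_lik_le hL hα
  refine ne_top_of_le_ne_top (ENNReal.coe_ne_top (r := M)) ?_
  calc ∫⁻ x, T.density α x ∂T.prior ≤ ∫⁻ _, M ∂T.prior :=
        lintegral_mono fun x => ENNReal.coe_le_coe.2 (hM x)
    _ = M := by simp

end TemperedTarget

namespace InnerMCMC

variable {X : Type*} [MeasurableSpace X] {S : ℕ} {T : TemperedTarget X S} (K : InnerMCMC T)

/-! ### The inner MCMC steps -/

/-- Invariance of the posterior, with its normalizing constant cancelled. The cancellation needs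
that constant to be finite, which comes from the bounded likelihood, and nonzero. -/
theorem lintegral_density_kernel (hL : BddAbove (Set.range T.lik)) {s : ℕ} (hs1 : 1 ≤ s)
    (hs : s ≤ S) {h : X → ℝ≥0∞} (hh : Measurable h) :
    ∫⁻ x, T.density (T.temp s) x * ∫⁻ y, h y ∂K.kernel s x ∂T.prior =
      ∫⁻ x, T.density (T.temp s) x * h x ∂T.prior := by
  have hinv : ∫⁻ x, h x ∂(T.posterior (T.temp s)).bind (K.kernel s) =
      ∫⁻ x, h x ∂T.posterior (T.temp s) := by rw [(K.invariant s hs1 hs).def]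
  rw [Measure.lintegral_bind (Kernel.aemeasurable _) hh.aemeasurable] at hinv
  simp only [TemperedTarget.posterior, lintegral_smul_measure, smul_eq_mul] at hinv
  have hc0 : (∫⁻ x, T.density (T.temp s) x ∂T.prior)⁻¹ ≠ 0 :=
    ENNReal.inv_ne_zero.2 (TemperedTarget.lintegral_density_ne_top hL (T.temp_nonneg hs))
  have hc1 : (∫⁻ x, T.density (T.temp s) x ∂T.prior)⁻¹ ≠ ∞ :=
    ENNReal.inv_ne_top.2 (T.lintegral_density_ne_zero _)
  have h2 : ∫⁻ x, ∫⁻ y, h y ∂K.kernel s x ∂T.prior.withDensity (T.density (T.temp s)) =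
      ∫⁻ x, h x ∂T.prior.withDensity (T.density (T.temp s)) :=
    (ENNReal.mul_right_inj hc0 hc1).1 hinv
  rw [lintegral_withDensity_eq_lintegral_mul _ (T.measurable_density _) hh.lintegral_kernel,
    lintegral_withDensity_eq_lintegral_mul _ (T.measurable_density _) hh] at h2
  exact h2

theorem lintegral_density_kernel_pow (hL : BddAbove (Set.range T.lik)) {s : ℕ} (hs1 : 1 ≤ s)
    (hs : s ≤ S) (m : ℕ) {h : X → ℝ≥0∞} (hh : Measurable h) :
    ∫⁻ x, T.density (T.temp s) x * ∫⁻ y, h y ∂(K.kernel s ^ m) x ∂T.prior =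
      ∫⁻ x, T.density (T.temp s) x * h x ∂T.prior := by
  induction m with
  | zero =>
    refine lintegral_congr fun x => ?_
    have : (K.kernel s ^ 0) x = Measure.dirac x := by
      rw [pow_zero]; exact Kernel.id_apply x
    rw [this, lintegral_dirac' _ hh]
  | succ m ih =>
    refine Eq.trans ?_ ((K.lintegral_density_kernel hL hs1 hs
      (hh.lintegral_kernel (κ := K.kernel s ^ m))).trans ih)
    refine lintegral_congr fun x => ?_
    rw [pow_succ]
    congr 1
    exact Kernel.lintegral_comp _ _ _ hh

/-- Two copies started together never separate under a faithful coupling, and by the marginal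
condition their common state evolves as one chain. -/
theorem lintegral_coupling_pow_diag [MeasurableEq X] {s : ℕ} (hs1 : 1 ≤ s) (hs : s ≤ S) (m : ℕ)
    {h : X → ℝ≥0∞} (hh : Measurable h) (x : X) :
    ∫⁻ z, Set.indicator {z : X × X | z.1 = z.2} (fun z => h z.1) z ∂(K.coupling s ^ m) (x, x) =
      ∫⁻ y, h y ∂(K.kernel s ^ m) x := by
  have hD : MeasurableSet {z : X × X | z.1 = z.2} :=
    measurableSet_eq_fun measurable_fst measurable_snd
  have hF : Measurable (Set.indicator {z : X × X | z.1 = z.2} fun z => h z.1) :=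
    (hh.comp measurable_fst).indicator hD
  induction m generalizing x with
  | zero =>
    have h1 : (K.coupling s ^ 0) (x, x) = Measure.dirac (x, x) := by
      rw [pow_zero]; exact Kernel.id_apply _
    have h2 : (K.kernel s ^ 0) x = Measure.dirac x := by
      rw [pow_zero]; exact Kernel.id_apply x
    rw [h1, h2, lintegral_dirac' _ hF, lintegral_dirac' _ hh]
    exact Set.indicator_of_mem (s := {z : X × X | z.1 = z.2}) rfl _
  | succ m ih =>
    have h1 : ∫⁻ z, Set.indicator {z : X × X | z.1 = z.2} (fun z => h z.1) z
        ∂(K.coupling s ^ (m + 1)) (x, x) =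
        ∫⁻ w, ∫⁻ z, Set.indicator {z : X × X | z.1 = z.2} (fun z => h z.1) z
          ∂(K.coupling s ^ m) w ∂K.coupling s (x, x) := by
      rw [pow_succ]
      exact Kernel.lintegral_comp _ _ _ hF
    have h2 : ∫⁻ y, h y ∂(K.kernel s ^ (m + 1)) x =
        ∫⁻ w, ∫⁻ y, h y ∂(K.kernel s ^ m) w ∂K.kernel s x := by
      rw [pow_succ]
      exact Kernel.lintegral_comp _ _ _ hh
    rw [h1, h2, ← K.map_fst s hs1 hs (x, x),
      lintegral_map (f := fun w => ∫⁻ y, h y ∂(K.kernel s ^ m) w) hh.lintegral_kernel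
        measurable_fst]
    refine lintegral_congr_ae ?_
    -- After one step the pair is almost surely diagonal, so the induction hypothesis applies at its
    -- common state.
    filter_upwards [K.faithful s hs1 hs x] with w hw
    rw [← ih w.1]
    congr 2
    exact Prod.ext rfl hw.symm

/-- With a common past, the extended lineages agree exactly when the new states do. -/
theorem lintegral_coupledMove_diag [MeasurableEq X] {s : ℕ} (hs : s < S) {h : X → ℝ≥0∞}
    (hh : Measurable h) (x : Traj X s) :
    ∫⁻ w, coupledFun h w ∂K.coupledMove s (x, x) =
      ∫⁻ y, h y ∂(K.kernel (s + 1) ^ K.steps (s + 1)) x.last := by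
  have hF := measurable_coupledFun (s := s + 1) hh
  have hmap : Measurable fun w : (Traj X s × Traj X s) × X × X =>
      (w.1.1.extend w.2.1, w.1.2.extend w.2.2) := by fun_prop
  have hF' : Measurable fun w : (Traj X s × Traj X s) × X × X =>
      coupledFun h (w.1.1.extend w.2.1, w.1.2.extend w.2.2) := hF.comp hmap
  rw [coupledMove, Kernel.lintegral_map _ hmap _ hF, Kernel.lintegral_id_prod hF',
    ← K.lintegral_coupling_pow_diag (Nat.succ_pos s) hs _ hh]
  rw [Kernel.comap_apply]
  refine lintegral_congr fun z => ?_
  by_cases hz : z.1 = z.2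
  · rw [coupledFun_of_eq _ (by simp [hz]), Set.indicator_of_mem (by exact hz)]
    simp [Traj.last, Traj.extend]
  · rw [coupledFun_of_ne, Set.indicator_of_notMem (by exact hz)]
    intro h
    apply hz
    have := congrFun h (Fin.last _)
    simpa [Traj.extend] using this

/-- Given the particles at stage `s`, the expectation of `h` over the coupled part of a new pair at
stage `s + 1`. -/
theorem coupledSum_div_le_lintegral_coupledStep [MeasurableEq X] {N : ℕ} [NeZero N] {s : ℕ}
    (hs : s < S) {h : X → ℝ≥0∞} (hh : Measurable h) (ξ : Fin N → Traj X s × Traj X s) {B : ℝ≥0}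
    (hB0 : B ≠ 0) (hB1 : ∑ i, T.weight s (ξ i).1.last ≤ B)
    (hB2 : ∑ i, T.weight s (ξ i).2.last ≤ B) :
    coupledSum (fun x => (T.weight s x : ℝ≥0∞) *
        ∫⁻ y, h y ∂(K.kernel (s + 1) ^ K.steps (s + 1)) x) ξ / B ≤
      ∫⁻ w, coupledFun h w ∂K.coupledStep N s ξ := by
  have hF := measurable_coupledFun (s := s + 1) hh
  rw [coupledStep, Kernel.lintegral_comp _ _ _ hF]
  refine le_trans (le_of_eq ?_) (sum_div_le_lintegral_coupledResampleKernel
    (T.measurable_weight s) ξ hF.lintegral_kernel hB0 hB1 hB2)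
  congr 1
  refine Finset.sum_congr rfl fun i _ => ?_
  by_cases hw : (ξ i).1 = (ξ i).2
  · rw [coupledFun_of_eq _ hw, Set.indicator_of_mem (by exact hw),
      ← K.lintegral_coupledMove_diag hs hh]
    congr 3
    exact Prod.ext rfl hw
  · rw [coupledFun_of_ne _ hw, Set.indicator_of_notMem (by exact hw)]

/-- Coupled MCMC steps do not separate a coupled pair. -/
theorem coupledStep_compl_le [MeasurableEq X] {N : ℕ} [NeZero N] {s : ℕ} (hs : s < S)
    (ξ : Fin N → Traj X s × Traj X s) :
    K.coupledStep N s ξ {w | w.1 = w.2}ᶜ ≤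
      coupledResampleKernel N (T.weight s) (T.measurable_weight s) ξ {w | w.1 = w.2}ᶜ := by
  have hDc := (measurableSet_traj_eq (X := X) (s := s + 1)).compl
  rw [coupledStep, Kernel.comp_apply' _ _ _ hDc,
    ← lintegral_indicator_one measurableSet_traj_eq.compl]
  refine lintegral_mono fun w => ?_
  by_cases hw : w.1 = w.2
  · obtain ⟨x, y⟩ := w
    obtain rfl : x = y := hw
    -- With `h = 1` this says that the diagonal has full mass after the move.
    have h1 := K.lintegral_coupledMove_diag hs (measurable_one (α := ℝ≥0∞) (β := X)) x
    rw [coupledFun_one, lintegral_indicator_one measurableSet_traj_eq] at h1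
    rw [prob_compl_eq_one_sub measurableSet_traj_eq, h1]
    simp
  · rw [Set.indicator_of_mem (by exact hw)]
    exact prob_le_one

end InnerMCMC

/-! ### Sums over independent particles -/

theorem lintegral_pi_sum {ι E : Type*} [Fintype ι] [MeasurableSpace E] (μ : ι → Measure E)
    [∀ i, IsProbabilityMeasure (μ i)] (I : Finset ι) {f : E → ℝ≥0∞} (hf : Measurable f) :
    ∫⁻ x, ∑ i ∈ I, f (x i) ∂Measure.pi μ = ∑ i ∈ I, ∫⁻ y, f y ∂μ i := by
  rw [lintegral_finsetSum _ fun i _ => by fun_prop]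
  exact Finset.sum_congr rfl fun i _ => (measurePreserving_eval μ i).lintegral_comp hf

theorem card_univ_erase_zero (N : ℕ) [NeZero N] :
    (Finset.univ.erase (0 : Fin N)).card = N - 1 := by
  rw [Finset.card_erase_of_mem (Finset.mem_univ _), Finset.card_univ, Fintype.card_fin]

/-- N ≥ 2 ensures that the N - 1 free particles are at least N/2. -/
theorem half_mul_natCast_le {N : ℕ} (hN : 2 ≤ N) (a : ℝ≥0∞) :
    a / 2 * N ≤ ((N - 1 : ℕ) : ℝ≥0∞) * a := by
  obtain ⟨n, rfl⟩ : ∃ n, N = n + 2 := ⟨N - 2, by omega⟩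
  have h : ((n + 2 : ℕ) : ℝ≥0∞) ≤ 2 * ((n + 2 - 1 : ℕ) : ℝ≥0∞) := by
    rw [show n + 2 - 1 = n + 1 by omega]
    exact_mod_cast (by omega : n + 2 ≤ 2 * (n + 1))
  calc a / 2 * ((n + 2 : ℕ) : ℝ≥0∞) ≤ a / 2 * (2 * ((n + 2 - 1 : ℕ) : ℝ≥0∞)) := by gcongr
    _ = a / 2 * 2 * ((n + 2 - 1 : ℕ) : ℝ≥0∞) := by rw [mul_assoc]
    _ = _ := by
      rw [ENNReal.div_mul_cancel (by norm_num) (by norm_num), mul_comm]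

section CoupledParticles

variable {X : Type*} [MeasurableSpace X] [MeasurableEq X] {s : ℕ}

/-- The deviation bound for the N - 1 free pairs. As (N - 1)q/4 ≥ qN/8, the threshold qN/8 is
admissible, and exp(-x) ≤ 1/x at x = qN/8 weakens the exponential to the rate 1/N needed here. -/
theorem measure_pi_coupledSum_lt_le {N : ℕ} [NeZero N] (hN : 2 ≤ N)
    (ν : Fin N → Measure (Traj X s × Traj X s)) [∀ i, IsProbabilityMeasure (ν i)] {h : X → ℝ≥0∞}
    (hh : Measurable h) (h1 : ∀ x, h x ≤ 1) {q : ℝ≥0} (hq0 : q ≠ 0)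
    (hq : ∀ i ≠ 0, q ≤ ∫⁻ w, coupledFun h w ∂ν i) :
    Measure.pi ν {ξ | coupledSum h ξ < (q / 8 : ℝ≥0) * N} ≤ (8 / q : ℝ≥0) / N := by
  have hqpos : (0 : ℝ) < q := by exact_mod_cast pos_iff_ne_zero.2 hq0
  have hN' : (2 : ℝ) ≤ N := by exact_mod_cast hN
  have h2 := measure_pi_sum_lt_le ν (Finset.univ.erase 0) (measurable_coupledFun (s := s) hh)
    (coupledFun_le h1) hqpos.le (fun i hi => by
      rw [ENNReal.ofReal_coe_nnreal]; exact hq i (Finset.ne_of_mem_erase hi))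
  rw [card_univ_erase_zero, Nat.cast_sub (by omega), Nat.cast_one] at h2
  have ht : (q : ℝ) / 8 * N ≤ (N - 1) * q / 4 := by nlinarith
  calc Measure.pi ν {ξ | coupledSum h ξ < (q / 8 : ℝ≥0) * N}
      ≤ Measure.pi ν {ξ | coupledSum h ξ < ENNReal.ofReal ((N - 1) * q / 4)} := by
        refine measure_mono fun ξ (hξ : coupledSum h ξ < _) =>
          show coupledSum h ξ < _ from hξ.trans_le ?_
        have h3 : ((q / 8 : ℝ≥0) : ℝ≥0∞) * N = ENNReal.ofReal ((q : ℝ) / 8 * N) := by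
          rw [ENNReal.ofReal_mul (by positivity), ENNReal.ofReal_natCast]
          congr 1
          rw [← ENNReal.ofReal_coe_nnreal]
          norm_num
        rw [h3]
        exact ENNReal.ofReal_le_ofReal ht
    _ ≤ ENNReal.ofReal (Real.exp (-((N - 1) * q / 4))) := h2
    _ ≤ ENNReal.ofReal ((8 : ℝ) / (q : ℝ) / (N : ℝ)) := by
        refine ENNReal.ofReal_le_ofReal ?_
        calc Real.exp (-((N - 1) * q / 4)) ≤ Real.exp (-(q / 8 * N)) :=
              Real.exp_le_exp.2 (by linarith)
          _ = (Real.exp (q / 8 * N))⁻¹ := Real.exp_neg _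
          _ ≤ ((q : ℝ) / 8 * (N : ℝ))⁻¹ := by
            refine inv_anti₀ (by positivity) ?_
            linarith [Real.add_one_le_exp ((q : ℝ) / 8 * N)]
          _ = (8 : ℝ) / (q : ℝ) / (N : ℝ) := by field_simp
    _ = (8 / q : ℝ≥0) / N := by
        rw [ENNReal.ofReal_div_of_pos (by positivity), ENNReal.ofReal_natCast]
        congr 1
        rw [← ENNReal.ofReal_coe_nnreal]
        norm_num

end CoupledParticles

/-! ### Recursion over the temperatures -/

namespace InnerMCMC

variable {X : Type*} [MeasurableSpace X] {S : ℕ} {T : TemperedTarget X S} (K : InnerMCMC T)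

section Recursion

variable {N : ℕ} [NeZero N]

theorem coupledParticles_zero (z : Traj X 0 × Traj X 0) :
    K.coupledParticles N 0 z = Measure.pi fun i => K.initLaw N i z := rfl

theorem lintegral_coupledParticles_succ {s : ℕ} (z : Traj X (s + 1) × Traj X (s + 1))
    {F : (Fin N → Traj X (s + 1) × Traj X (s + 1)) → ℝ≥0∞} (hF : Measurable F) :
    ∫⁻ η, F η ∂K.coupledParticles N (s + 1) z =
      ∫⁻ ξ, ∫⁻ η, F η ∂Measure.pi (fun i => K.stepLaw N s i (z, ξ))
        ∂K.coupledParticles N s (z.1.init, z.2.init) := by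
  rw [coupledParticles, Kernel.lintegral_comp _ _ _ hF,
    Kernel.lintegral_id_prod hF.lintegral_kernel, Kernel.comap_apply]
  rfl

theorem initLaw_of_ne {i : Fin N} (hi : i ≠ 0) (z : Traj X 0 × Traj X 0) :
    K.initLaw N i z = T.prior.map fun x => (Traj.single x, Traj.single x) := by
  rw [initLaw, if_neg hi, Kernel.const_apply]

theorem stepLaw_of_ne {s : ℕ} {i : Fin N} (hi : i ≠ 0) (z : Traj X (s + 1) × Traj X (s + 1))
    (ξ : Fin N → Traj X s × Traj X s) : K.stepLaw N s i (z, ξ) = K.coupledStep N s ξ := by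
  rw [stepLaw, if_neg hi, Kernel.comap_apply]

variable [MeasurableEq X]

theorem lintegral_coupledFun_initLaw {h : X → ℝ≥0∞} (hh : Measurable h) {i : Fin N} (hi : i ≠ 0)
    (z : Traj X 0 × Traj X 0) :
    ∫⁻ w, coupledFun h w ∂K.initLaw N i z = ∫⁻ x, h x ∂T.prior := by
  rw [K.initLaw_of_ne hi, lintegral_map (measurable_coupledFun hh) (by fun_prop)]
  exact lintegral_congr fun x => coupledFun_diag h _

end Recursion

/-- The function `(p(y ∣ ·)^(α_{s+1} - α_s) / M) P^m h`. -/
def pullback (s : ℕ) (M : ℝ≥0) (h : X → ℝ≥0∞) (x : X) : ℝ≥0∞ :=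
  (M : ℝ≥0∞)⁻¹ * ((T.weight s x : ℝ≥0∞) *
    ∫⁻ y, h y ∂(K.kernel (s + 1) ^ K.steps (s + 1)) x)

theorem measurable_pullback (s : ℕ) (M : ℝ≥0) {h : X → ℝ≥0∞} (hh : Measurable h) :
    Measurable (K.pullback s M h) :=
  ((T.measurable_weight s).coe_nnreal_ennreal.mul hh.lintegral_kernel).const_mul _

theorem inv_mul_le_one {M : ℝ≥0} (hM0 : M ≠ 0) {a : ℝ≥0∞} (ha : a ≤ M) :
    (M : ℝ≥0∞)⁻¹ * a ≤ 1 := by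
  calc (M : ℝ≥0∞)⁻¹ * a ≤ (M : ℝ≥0∞)⁻¹ * M := by gcongr
    _ = 1 := ENNReal.inv_mul_cancel (by exact_mod_cast hM0) ENNReal.coe_ne_top

theorem pullback_le_one {s : ℕ} {M : ℝ≥0} (hM0 : M ≠ 0) (hM : ∀ x, T.weight s x ≤ M)
    {h : X → ℝ≥0∞} (h1 : ∀ x, h x ≤ 1) (x : X) : K.pullback s M h x ≤ 1 := by
  refine inv_mul_le_one hM0 ?_
  calc (T.weight s x : ℝ≥0∞) * ∫⁻ y, h y ∂(K.kernel (s + 1) ^ K.steps (s + 1)) x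
      ≤ M * ∫⁻ _, 1 ∂(K.kernel (s + 1) ^ K.steps (s + 1)) x := by
        gcongr with y
        · exact hM x
        · exact h1 y
    _ = M := by simp

/-- The stage-s density times the weight is the stage-(s+1) density, and integration against the
latter is unaffected by the moves. Positivity thus passes from `h` to its pullback; this is where
invariance enters. -/
theorem lintegral_density_pullback_ne_zero (hL : BddAbove (Set.range T.lik)) {s : ℕ} (hs : s < S)
    (M : ℝ≥0) {h : X → ℝ≥0∞} (hh : Measurable h)
    (hpos : ∫⁻ x, T.density (T.temp (s + 1)) x * h x ∂T.prior ≠ 0) :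
    ∫⁻ x, T.density (T.temp s) x * K.pullback s M h x ∂T.prior ≠ 0 := by
  rw [← K.lintegral_density_kernel_pow hL (Nat.succ_pos s) hs (K.steps (s + 1)) hh] at hpos
  have h1 : ∀ x, T.density (T.temp s) x * K.pullback s M h x = (M : ℝ≥0∞)⁻¹ *
      (T.density (T.temp (s + 1)) x *
        ∫⁻ y, h y ∂(K.kernel (s + 1) ^ K.steps (s + 1)) x) := by
    intro x
    rw [pullback, ← T.density_mul_weight hs]
    ring
  have hm : Measurable fun x => T.density (T.temp (s + 1)) x *
      ∫⁻ y, h y ∂(K.kernel (s + 1) ^ K.steps (s + 1)) x :=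
    (T.measurable_density _).mul hh.lintegral_kernel
  simp only [h1]
  rw [lintegral_const_mul _ hm]
  exact mul_ne_zero (ENNReal.inv_ne_zero.2 ENNReal.coe_ne_top) hpos

variable [MeasurableEq X]

/-- The crude normalizer `N * M` turns the one-step bound into a linear functional of the stage-s
particles, to which the recursion applies. -/
theorem coupledSum_pullback_div_le {N : ℕ} [NeZero N] {s : ℕ} (hs : s < S) {M : ℝ≥0} (hM0 : M ≠ 0)
    (hM : ∀ x, T.weight s x ≤ M) {h : X → ℝ≥0∞} (hh : Measurable h)
    (ξ : Fin N → Traj X s × Traj X s) :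
    coupledSum (K.pullback s M h) ξ / N ≤ ∫⁻ w, coupledFun h w ∂K.coupledStep N s ξ := by
  have hN0 : (N : ℝ≥0) ≠ 0 := by exact_mod_cast NeZero.ne N
  refine le_trans (le_of_eq ?_) (K.coupledSum_div_le_lintegral_coupledStep hs hh ξ
    (mul_ne_zero hN0 hM0) (sum_weight_le_mul hM fun i => (ξ i).1.last)
    (sum_weight_le_mul hM fun i => (ξ i).2.last))
  have h1 : K.pullback s M h = fun x => (M : ℝ≥0∞)⁻¹ * ((T.weight s x : ℝ≥0∞) *
    ∫⁻ y, h y ∂(K.kernel (s + 1) ^ K.steps (s + 1)) x) := rfl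
  rw [h1, coupledSum_const_mul, ENNReal.div_eq_inv_mul, ENNReal.div_eq_inv_mul, ENNReal.coe_mul,
    ENNReal.mul_inv (Or.inl (by exact_mod_cast hN0)) (Or.inl ENNReal.coe_ne_top),
    ENNReal.coe_natCast, mul_assoc]

/-- Uniformly in the reference pair, the sum of `h` over the coupled particles at stage `s` is of
order `N` outside an event of probability `O(1/N)`. -/
theorem exists_coupledParticles_coupledSum_lt_le (hL : BddAbove (Set.range T.lik)) {s : ℕ}
    (hs : s ≤ S) {h : X → ℝ≥0∞} (hh : Measurable h) (h1 : ∀ x, h x ≤ 1)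
    (hpos : ∫⁻ x, T.density (T.temp s) x * h x ∂T.prior ≠ 0) :
    ∃ ε c : ℝ≥0, ε ≠ 0 ∧ ∀ (N : ℕ) [NeZero N], 2 ≤ N → ∀ z : Traj X s × Traj X s,
      K.coupledParticles N s z {ξ | coupledSum h ξ < ε * N} ≤ c / N := by
  -- The hypothesis is needed for the pullback of `h`, hence for all test functions at once.
  induction s generalizing h with
  | zero =>
    rw [T.density_zero] at hpos
    simp only [Pi.one_apply, one_mul] at hpos
    have hfin : ∫⁻ x, h x ∂T.prior ≠ ∞ := by
      refine ne_top_of_le_ne_top ENNReal.one_ne_top ((lintegral_mono h1).trans ?_)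
      simp
    obtain ⟨q, hq⟩ : ∃ q : ℝ≥0, (q : ℝ≥0∞) = ∫⁻ x, h x ∂T.prior :=
      ⟨_, ENNReal.coe_toNNReal hfin⟩
    have hq0 : q ≠ 0 := by
      rintro rfl
      exact hpos hq.symm
    refine ⟨q / 8, 8 / q, by positivity, fun N _ hN z => ?_⟩
    rw [coupledParticles_zero]
    exact measure_pi_coupledSum_lt_le hN _ hh h1 hq0 fun i hi =>
      (hq.trans (K.lintegral_coupledFun_initLaw hh hi z).symm).le
  | succ s ih =>
    obtain ⟨M, hM0, hM⟩ := TemperedTarget.exists_weight_le hL hs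
    obtain ⟨ε, c, hε, hc⟩ := ih (Nat.le_of_succ_le hs) (K.measurable_pullback s M hh)
      (K.pullback_le_one hM0 hM h1) (K.lintegral_density_pullback_ne_zero hL hs M hh hpos)
    -- Two sources of failure: too little coupled pullback mass at stage s (c), or a downward
    -- fluctuation of the new pairs, whose conditional means are at least ε (8/ε).
    refine ⟨ε / 8, c + 8 / ε, by positivity, fun N _ hN z => ?_⟩
    have hN0 : (N : ℝ≥0∞) ≠ 0 := by exact_mod_cast NeZero.ne N
    have hA : MeasurableSet {ξ : Fin N → Traj X (s + 1) × Traj X (s + 1) |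
        coupledSum h ξ < (ε / 8 : ℝ≥0) * N} :=
      measurableSet_lt (measurable_coupledSum hh) measurable_const
    have hB : MeasurableSet {ξ : Fin N → Traj X s × Traj X s |
        coupledSum (K.pullback s M h) ξ < ε * N} :=
      measurableSet_lt (measurable_coupledSum (K.measurable_pullback s M hh)) measurable_const
    rw [← lintegral_indicator_one hA,
      K.lintegral_coupledParticles_succ z (measurable_one.indicator hA)]
    calc ∫⁻ ξ, ∫⁻ η, Set.indicator {ξ | coupledSum h ξ < (ε / 8 : ℝ≥0) * N} 1 η
          ∂Measure.pi (fun i => K.stepLaw N s i (z, ξ))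
          ∂K.coupledParticles N s (z.1.init, z.2.init)
        ≤ ∫⁻ ξ, (Set.indicator {ξ | coupledSum (K.pullback s M h) ξ < ε * N} 1 ξ +
            (8 / ε : ℝ≥0) / N) ∂K.coupledParticles N s (z.1.init, z.2.init) := by
          refine lintegral_mono fun ξ => ?_
          rw [lintegral_indicator_one hA]
          by_cases hξ : coupledSum (K.pullback s M h) ξ < ε * N
          · rw [Set.indicator_of_mem (by exact hξ)]
            exact prob_le_one.trans le_self_add
          · rw [Set.indicator_of_notMem (by exact hξ), zero_add]
            refine measure_pi_coupledSum_lt_le hN _ hh h1 hε fun i hi => ?_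
            rw [K.stepLaw_of_ne hi]
            refine le_trans ?_ (K.coupledSum_pullback_div_le hs hM0 hM hh ξ)
            rw [ENNReal.le_div_iff_mul_le (Or.inl hN0) (Or.inl (ENNReal.natCast_ne_top N))]
            exact not_lt.1 hξ
      _ = K.coupledParticles N s (z.1.init, z.2.init)
            {ξ | coupledSum (K.pullback s M h) ξ < ε * N} + (8 / ε : ℝ≥0) / N := by
          rw [lintegral_add_left (measurable_one.indicator hB), lintegral_indicator_one hB,
            lintegral_const, measure_univ, mul_one]
      _ ≤ c / N + (8 / ε : ℝ≥0) / N := by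
          gcongr
          exact hc N hN _
      _ = (c + 8 / ε : ℝ≥0) / N := by
          rw [← ENNReal.add_div, ← ENNReal.coe_add]

/-- Uniformly in the reference pair, the expected sum of `h` over the coupled particles at stage `s`
is of order `N`. -/
theorem exists_le_lintegral_coupledSum (hL : BddAbove (Set.range T.lik)) {s : ℕ}
    (hs : s ≤ S) {h : X → ℝ≥0∞} (hh : Measurable h) (h1 : ∀ x, h x ≤ 1)
    (hpos : ∫⁻ x, T.density (T.temp s) x * h x ∂T.prior ≠ 0) :
    ∃ δ : ℝ≥0∞, δ ≠ 0 ∧ ∀ (N : ℕ) [NeZero N], 2 ≤ N → ∀ z : Traj X s × Traj X s,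
      δ * N ≤ ∫⁻ ξ, coupledSum h ξ ∂K.coupledParticles N s z := by
  induction s generalizing h with
  | zero =>
    rw [T.density_zero] at hpos
    simp only [Pi.one_apply, one_mul] at hpos
    refine ⟨(∫⁻ x, h x ∂T.prior) / 2, ENNReal.div_ne_zero.2 ⟨hpos, by norm_num⟩,
      fun N _ hN z => ?_⟩
    refine (half_mul_natCast_le hN _).trans (le_of_eq ?_)
    rw [coupledParticles_zero]
    simp only [coupledSum]
    rw [lintegral_pi_sum _ _ (measurable_coupledFun hh), ← card_univ_erase_zero N,
      ← nsmul_eq_mul, ← Finset.sum_const]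
    exact Finset.sum_congr rfl fun i hi =>
      (K.lintegral_coupledFun_initLaw hh (Finset.ne_of_mem_erase hi) z).symm
  | succ s ih =>
    obtain ⟨M, hM0, hM⟩ := TemperedTarget.exists_weight_le hL hs
    obtain ⟨δ, hδ, hc⟩ := ih (Nat.le_of_succ_le hs) (K.measurable_pullback s M hh)
      (K.pullback_le_one hM0 hM h1) (K.lintegral_density_pullback_ne_zero hL hs M hh hpos)
    -- Passing from N to N - 1 free pairs costs at most a factor 2 per stage.
    refine ⟨δ / 2, ENNReal.div_ne_zero.2 ⟨hδ, by norm_num⟩, fun N _ hN z => ?_⟩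
    have hN0 : (N : ℝ≥0∞) ≠ 0 := by exact_mod_cast NeZero.ne N
    have hm := K.measurable_pullback s M hh
    rw [K.lintegral_coupledParticles_succ z (measurable_coupledSum hh)]
    calc δ / 2 * N ≤ ((N - 1 : ℕ) : ℝ≥0∞) * δ := half_mul_natCast_le hN _
      _ ≤ ((N - 1 : ℕ) : ℝ≥0∞) * ∫⁻ ξ, coupledSum (K.pullback s M h) ξ / N
            ∂K.coupledParticles N s (z.1.init, z.2.init) := by
          gcongr
          simp only [div_eq_mul_inv]
          rw [lintegral_mul_const _ (measurable_coupledSum hm), ← div_eq_mul_inv,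
            ENNReal.le_div_iff_mul_le (Or.inl hN0) (Or.inl (ENNReal.natCast_ne_top N))]
          exact hc N hN _
      _ = ∫⁻ ξ, ((N - 1 : ℕ) : ℝ≥0∞) * (coupledSum (K.pullback s M h) ξ / N)
            ∂K.coupledParticles N s (z.1.init, z.2.init) :=
          (lintegral_const_mul _ ((measurable_coupledSum hm).div_const _)).symm
      _ ≤ _ := by
          refine lintegral_mono fun ξ => ?_
          change _ ≤ ∫⁻ η, ∑ i ∈ Finset.univ.erase 0, coupledFun h (η i)
            ∂Measure.pi fun i => K.stepLaw N s i (z, ξ)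
          rw [lintegral_pi_sum _ _ (measurable_coupledFun hh), ← card_univ_erase_zero N,
            ← nsmul_eq_mul, ← Finset.sum_const]
          refine Finset.sum_le_sum fun i hi => ?_
          rw [K.stepLaw_of_ne (Finset.ne_of_mem_erase hi)]
          exact K.coupledSum_pullback_div_le hs hM0 hM hh ξ

/-- If the expected number of uncoupled particles is bounded, resampling with bounded weights `g`
fails to return a coupled pair with probability `O(1/N)`. -/
theorem exists_lintegral_coupledResampleKernel_compl_le (hL : BddAbove (Set.range T.lik)) {s : ℕ}
    (hs : s ≤ S) {g : X → ℝ≥0} (hg : Measurable g) {M : ℝ≥0} (hM0 : M ≠ 0) (hM : ∀ x, g x ≤ M)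
    (hpos : ∫⁻ x, T.density (T.temp s) x * g x ∂T.prior ≠ 0)
    (hV : ∃ c : ℝ≥0, ∀ (N : ℕ) [NeZero N], 2 ≤ N → ∀ z : Traj X s × Traj X s,
      ∫⁻ ξ, uncoupledCount ξ ∂K.coupledParticles N s z ≤ c) :
    ∃ c : ℝ≥0, ∀ (N : ℕ) [NeZero N], 2 ≤ N → ∀ z : Traj X s × Traj X s,
      ∫⁻ ξ, coupledResampleKernel N g hg ξ {w | w.1 = w.2}ᶜ ∂K.coupledParticles N s z ≤ c / N := by
  obtain ⟨v, hv⟩ := hV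
  have hMinv : (M : ℝ≥0∞)⁻¹ ≠ 0 := ENNReal.inv_ne_zero.2 ENNReal.coe_ne_top
  have hMc : (M : ℝ≥0∞) ≠ 0 := by exact_mod_cast hM0
  have hpos' : ∫⁻ x, T.density (T.temp s) x * ((M : ℝ≥0∞)⁻¹ * g x) ∂T.prior ≠ 0 := by
    simp only [mul_left_comm _ (M : ℝ≥0∞)⁻¹]
    rw [lintegral_const_mul' _ _ (ENNReal.inv_ne_top.2 hMc)]
    exact mul_ne_zero hMinv hpos
  obtain ⟨ε, c, hε, hc⟩ := K.exists_coupledParticles_coupledSum_lt_le hL hs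
    (hg.coe_nnreal_ennreal.const_mul (M : ℝ≥0∞)⁻¹)
    (fun x => inv_mul_le_one hM0 (ENNReal.coe_le_coe.2 (hM x))) hpos'
  -- c covers the event that the coupled weight is below MεN. Off it, failure is at most M(1 +
  -- V)/(MεN), where the number V of uncoupled pairs has mean at most v.
  refine ⟨c + (1 + v) / ε, fun N _ hN z => ?_⟩
  have hN0 : (N : ℝ≥0∞) ≠ 0 := by exact_mod_cast NeZero.ne N
  have hεc : (ε : ℝ≥0∞) ≠ 0 := by exact_mod_cast hε
  have ha : (M * (ε * N) : ℝ≥0∞) ≠ 0 := mul_ne_zero hMc (mul_ne_zero hεc hN0)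
  have hset : {ξ : Fin N → Traj X s × Traj X s | coupledSum (fun x => (g x : ℝ≥0∞)) ξ <
      M * (ε * N)} = {ξ | coupledSum (fun x => (M : ℝ≥0∞)⁻¹ * g x) ξ < ε * N} := by
    ext ξ
    simp only [Set.mem_ofPred_eq, coupledSum_const_mul]
    rw [← ENNReal.div_eq_inv_mul, ENNReal.div_lt_iff (Or.inl hMc) (Or.inl ENNReal.coe_ne_top),
      mul_comm]
  have hA : MeasurableSet {ξ : Fin N → Traj X s × Traj X s |
      coupledSum (fun x => (g x : ℝ≥0∞)) ξ < M * (ε * N)} :=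
    measurableSet_lt (measurable_coupledSum hg.coe_nnreal_ennreal) measurable_const
  have hcancel : ∀ b : ℝ≥0∞, M * b / (M * (ε * N)) = b / (ε * N) := fun b =>
    ENNReal.mul_div_mul_left _ _ hMc ENNReal.coe_ne_top
  calc ∫⁻ ξ, coupledResampleKernel N g hg ξ {w | w.1 = w.2}ᶜ ∂K.coupledParticles N s z
      ≤ ∫⁻ ξ, (Set.indicator {ξ | coupledSum (fun x => (g x : ℝ≥0∞)) ξ < M * (ε * N)} 1 ξ +
          (1 + uncoupledCount ξ) / (ε * N)) ∂K.coupledParticles N s z := by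
        refine lintegral_mono fun ξ => ?_
        rw [← hcancel]
        exact coupledResampleKernel_compl_le hg hM ha ξ
    _ = K.coupledParticles N s z {ξ | coupledSum (fun x => (M : ℝ≥0∞)⁻¹ * g x) ξ < ε * N} +
          (1 + ∫⁻ ξ, uncoupledCount ξ ∂K.coupledParticles N s z) / (ε * N) := by
        rw [lintegral_add_left (measurable_one.indicator hA), lintegral_indicator_one hA, hset]
        simp only [div_eq_mul_inv]
        rw [lintegral_mul_const' _ _ (ENNReal.inv_ne_top.2 (mul_ne_zero hεc hN0)),
          lintegral_add_left measurable_const, lintegral_const, measure_univ, mul_one]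
    _ ≤ c / N + (1 + v) / (ε * N) := by
        gcongr
        · exact hc N hN z
        · exact hv N hN z
    _ = (c + (1 + v) / ε : ℝ≥0) / N := by
        rw [ENNReal.coe_add, ENNReal.add_div, ENNReal.coe_div hε, ENNReal.coe_add,
          ENNReal.coe_one]
        simp only [div_eq_mul_inv]
        rw [ENNReal.mul_inv (Or.inl hεc) (Or.inl ENNReal.coe_ne_top)]
        ring

/-- The expected number of uncoupled particles is bounded, uniformly in the number of particles and
in the reference pair. -/
theorem exists_lintegral_uncoupledCount_le (hL : BddAbove (Set.range T.lik)) {s : ℕ}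
    (hs : s ≤ S) :
    ∃ c : ℝ≥0, ∀ (N : ℕ) [NeZero N], 2 ≤ N → ∀ z : Traj X s × Traj X s,
      ∫⁻ ξ, uncoupledCount ξ ∂K.coupledParticles N s z ≤ c := by
  induction s with
  | zero =>
    -- At stage 0 only the reference pair can be uncoupled.
    refine ⟨1, fun N _ hN z => ?_⟩
    rw [coupledParticles_zero]
    simp only [uncoupledCount]
    have hD := (measurableSet_traj_eq (X := X) (s := 0)).compl
    rw [lintegral_pi_sum _ _ (measurable_one.indicator hD),
      ← Finset.add_sum_erase _ _ (Finset.mem_univ (0 : Fin N))]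
    rw [Finset.sum_eq_zero fun i hi => ?_, add_zero, lintegral_indicator_one hD]
    · exact prob_le_one
    · rw [K.initLaw_of_ne (Finset.ne_of_mem_erase hi), lintegral_indicator_one hD,
        Measure.map_apply (by fun_prop) hD]
      simp
  | succ s ih =>
    obtain ⟨M, hM0, hM⟩ := TemperedTarget.exists_weight_le hL hs
    have hpos : ∫⁻ x, T.density (T.temp s) x * (T.weight s x : ℝ≥0∞) ∂T.prior ≠ 0 := by
      simp only [T.density_mul_weight hs]
      exact T.lintegral_density_ne_zero _
    obtain ⟨c, hc⟩ := K.exists_lintegral_coupledResampleKernel_compl_le hL (Nat.le_of_succ_le hs)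
      (T.measurable_weight s) hM0 hM hpos (ih (Nat.le_of_succ_le hs))
    -- 1 for the reference pair; at most N free pairs, each uncoupled with probability at most c/N.
    refine ⟨1 + c, fun N _ hN z => ?_⟩
    have hN0 : (N : ℝ≥0∞) ≠ 0 := by exact_mod_cast NeZero.ne N
    have hD := (measurableSet_traj_eq (X := X) (s := s + 1)).compl
    have hDs := (measurableSet_traj_eq (X := X) (s := s)).compl
    rw [K.lintegral_coupledParticles_succ z measurable_uncoupledCount]
    calc ∫⁻ ξ, ∫⁻ η, uncoupledCount η ∂Measure.pi (fun i => K.stepLaw N s i (z, ξ))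
          ∂K.coupledParticles N s (z.1.init, z.2.init)
        ≤ ∫⁻ ξ, (1 + N * coupledResampleKernel N (T.weight s) (T.measurable_weight s) ξ
            {w | w.1 = w.2}ᶜ) ∂K.coupledParticles N s (z.1.init, z.2.init) := by
          refine lintegral_mono fun ξ => ?_
          simp only [uncoupledCount]
          rw [lintegral_pi_sum _ _ (measurable_one.indicator hD),
            ← Finset.add_sum_erase _ _ (Finset.mem_univ (0 : Fin N))]
          simp only [lintegral_indicator_one hD]
          refine add_le_add prob_le_one ?_
          calc ∑ i ∈ Finset.univ.erase 0, K.stepLaw N s i (z, ξ) {w | w.1 = w.2}ᶜ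
              ≤ ∑ _i ∈ Finset.univ.erase (0 : Fin N), coupledResampleKernel N (T.weight s)
                  (T.measurable_weight s) ξ {w | w.1 = w.2}ᶜ := by
                refine Finset.sum_le_sum fun i hi => ?_
                rw [K.stepLaw_of_ne (Finset.ne_of_mem_erase hi)]
                exact K.coupledStep_compl_le hs ξ
            _ ≤ ∑ _i : Fin N, coupledResampleKernel N (T.weight s)
                  (T.measurable_weight s) ξ {w | w.1 = w.2}ᶜ :=
                Finset.sum_le_sum_of_subset (Finset.erase_subset _ _)
            _ = _ := by simp
      _ = 1 + N * ∫⁻ ξ, coupledResampleKernel N (T.weight s) (T.measurable_weight s) ξ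
            {w | w.1 = w.2}ᶜ ∂K.coupledParticles N s (z.1.init, z.2.init) := by
          rw [lintegral_add_left measurable_const, lintegral_const, measure_univ, mul_one,
            lintegral_const_mul _ (Kernel.measurable_coe _ hDs)]
      _ ≤ 1 + N * (c / N) := by
          gcongr
          exact hc N hN _
      _ = (1 + c : ℝ≥0) := by
          rw [ENNReal.mul_div_cancel hN0 (ENNReal.natCast_ne_top N), ENNReal.coe_add,
            ENNReal.coe_one]

/-! ### Meeting probability of one coupled step -/

theorem exists_coupledCSMC_compl_le (hL : BddAbove (Set.range T.lik)) :
    ∃ c : ℝ≥0, ∀ (N : ℕ) [NeZero N], 2 ≤ N → ∀ z : Traj X S × Traj X S,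
      K.coupledCSMC N z {w | w.1 = w.2}ᶜ ≤ c / N := by
  obtain ⟨M, hM0, hM⟩ := TemperedTarget.exists_finalWeight_le hL
  have hpos : ∫⁻ x, T.density (T.temp S) x * (T.finalWeight x : ℝ≥0∞) ∂T.prior ≠ 0 := by
    simp only [T.density_mul_finalWeight]
    exact T.evidence_pos.ne'
  obtain ⟨c, hc⟩ := K.exists_lintegral_coupledResampleKernel_compl_le hL le_rfl
    T.measurable_finalWeight hM0 hM hpos (K.exists_lintegral_uncoupledCount_le hL le_rfl)
  refine ⟨c, fun N _ hN z => ?_⟩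
  rw [coupledCSMC, Kernel.comp_apply' _ _ _ measurableSet_traj_eq.compl]
  exact hc N hN z

/-- Covers the small N for which the failure bound c/N is void. It rests on expectations rather than
deviations, so it is informative for every N ≥ 2. -/
theorem exists_le_coupledCSMC (hL : BddAbove (Set.range T.lik)) :
    ∃ δ : ℝ≥0∞, δ ≠ 0 ∧ ∀ (N : ℕ) [NeZero N], 2 ≤ N → ∀ z : Traj X S × Traj X S,
      δ ≤ K.coupledCSMC N z {w | w.1 = w.2} := by
  obtain ⟨M, hM0, hM⟩ := TemperedTarget.exists_finalWeight_le hL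
  have hMc : (M : ℝ≥0∞) ≠ 0 := by exact_mod_cast hM0
  have hpos : ∫⁻ x, T.density (T.temp S) x * ((M : ℝ≥0∞)⁻¹ * T.finalWeight x) ∂T.prior ≠ 0 := by
    simp only [mul_left_comm _ (M : ℝ≥0∞)⁻¹, T.density_mul_finalWeight]
    rw [lintegral_const_mul _ T.measurable_lik.coe_nnreal_ennreal]
    exact mul_ne_zero (ENNReal.inv_ne_zero.2 ENNReal.coe_ne_top) T.evidence_pos.ne'
  have hm := T.measurable_finalWeight.coe_nnreal_ennreal.const_mul (M : ℝ≥0∞)⁻¹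
  obtain ⟨δ, hδ, hc⟩ := K.exists_le_lintegral_coupledSum hL le_rfl hm
    (fun x => inv_mul_le_one hM0 (ENNReal.coe_le_coe.2 (hM x))) hpos
  refine ⟨δ, hδ, fun N _ hN z => ?_⟩
  have hN0 : (N : ℝ≥0∞) ≠ 0 := by exact_mod_cast NeZero.ne N
  have hN1 : (N : ℝ≥0) ≠ 0 := by exact_mod_cast NeZero.ne N
  rw [coupledCSMC, Kernel.comp_apply' _ _ _ measurableSet_traj_eq]
  calc δ ≤ ∫⁻ ξ, coupledSum (fun x => (M : ℝ≥0∞)⁻¹ * T.finalWeight x) ξ / N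
        ∂K.coupledParticles N S z := by
        simp only [div_eq_mul_inv]
        rw [lintegral_mul_const _ (measurable_coupledSum hm), ← div_eq_mul_inv,
          ENNReal.le_div_iff_mul_le (Or.inl hN0) (Or.inl (ENNReal.natCast_ne_top N))]
        exact hc N hN z
    _ ≤ _ := by
        refine lintegral_mono fun ξ => le_trans (le_of_eq ?_)
          (coupledSum_div_le_coupledResampleKernel T.measurable_finalWeight ξ
            (mul_ne_zero hN1 hM0) (sum_weight_le_mul hM fun i => (ξ i).1.last)
            (sum_weight_le_mul hM fun i => (ξ i).2.last))
        rw [coupledSum_const_mul, ENNReal.div_eq_inv_mul, ENNReal.div_eq_inv_mul,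
          ENNReal.coe_mul, ENNReal.mul_inv (Or.inl (by exact_mod_cast hN1))
          (Or.inl ENNReal.coe_ne_top), ENNReal.coe_natCast, mul_assoc]

/-- The chains meet in one step of coupled conditional SMC with probability at least
`N / (N + c)`. -/
theorem exists_div_le_coupledCSMC_real (hL : BddAbove (Set.range T.lik)) :
    ∃ c : ℝ, 0 ≤ c ∧ ∀ (N : ℕ) [NeZero N], 2 ≤ N → ∀ z : Traj X S × Traj X S,
      (N : ℝ) / (N + c) ≤ (K.coupledCSMC N z).real {w | w.1 = w.2} := by
  obtain ⟨c, hc⟩ := K.exists_coupledCSMC_compl_le hL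
  obtain ⟨δ', hδ', hd'⟩ := K.exists_le_coupledCSMC hL
  obtain ⟨δ, hδ, hle⟩ : ∃ δ : ℝ≥0, 0 < δ ∧ (δ : ℝ≥0∞) ≤ δ' := by
    obtain ⟨δ, h1, h2⟩ := ENNReal.lt_iff_exists_nnreal_btwn.1 (pos_iff_ne_zero.2 hδ')
    exact ⟨δ, by exact_mod_cast h1, h2.le⟩
  -- From N(1 - p) ≤ c and p ≥ δ one gets N(1 - p) ≤ p(c/δ), that is, p ≥ N/(N + c/δ).
  refine ⟨c / δ, by positivity, fun N _ hN z => ?_⟩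
  have hNpos : (0 : ℝ) < N := by exact_mod_cast Nat.pos_of_neZero N
  have hδr : (0 : ℝ) < δ := by exact_mod_cast hδ
  set p := (K.coupledCSMC N z).real {w | w.1 = w.2} with hp
  have h1 : (δ : ℝ) ≤ p := by
    rw [hp, Measure.real, ← ENNReal.coe_toReal]
    exact ENNReal.toReal_mono (measure_ne_top _ _) (hle.trans (hd' N hN z))
  have h2 : 1 - p ≤ c / N := by
    rw [hp, ← probReal_compl_eq_one_sub measurableSet_traj_eq, Measure.real]
    have h3 := ENNReal.toReal_mono (ENNReal.div_ne_top ENNReal.coe_ne_top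
      (by exact_mod_cast NeZero.ne N)) (hc N hN z)
    simpa using h3
  have h3 : N * (1 - p) ≤ c := by
    rw [le_div_iff₀ hNpos] at h2
    linarith
  have h4 : (c : ℝ) ≤ p * (c / δ) := by
    calc (c : ℝ) = δ * (c / δ) := by field_simp
      _ ≤ p * (c / δ) := by gcongr
  rw [div_le_iff₀ (by positivity)]
  linarith

end InnerMCMC

/-! ### The meeting time -/

/-- If the first meeting is at index f, the time is f + 1 and exactly f indicators equal 1; if there
is none, the series diverges. -/
theorem meetingTime_le_one_add_tsum {E : Type*} (ω : ℕ → E × E) :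
    meetingTime ω ≤
      1 + ∑' n : ℕ, Set.indicator {ω : ℕ → E × E | ∀ k ≤ n, (ω k).1 ≠ (ω k).2} 1 ω := by
  classical
  by_cases h : ∃ n, (ω n).1 = (ω n).2
  · have h1 : meetingTime ω ≤ ((Nat.find h + 1 : ℕ) : ℝ≥0∞) :=
      iInf₂_le (Nat.find h) (Nat.find_spec h)
    refine h1.trans ?_
    rw [Nat.cast_add, Nat.cast_one, add_comm]
    gcongr
    refine le_trans (le_of_eq ?_) (ENNReal.sum_le_tsum (Finset.range (Nat.find h)))
    rw [Finset.sum_congr rfl fun n hn => ?_, Finset.sum_const, Finset.card_range,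
      nsmul_eq_mul, mul_one]
    refine Set.indicator_of_mem (s := {ω : ℕ → E × E | ∀ k ≤ n, (ω k).1 ≠ (ω k).2}) ?_ _
    exact fun k hk => Nat.find_min h (lt_of_le_of_lt hk (Finset.mem_range.1 hn))
  · rw [not_exists] at h
    have h1 : ∀ n : ℕ, Set.indicator {ω : ℕ → E × E | ∀ k ≤ n, (ω k).1 ≠ (ω k).2}
        (1 : (ℕ → E × E) → ℝ≥0∞) ω = 1 := fun n =>
      Set.indicator_of_mem (s := {ω : ℕ → E × E | ∀ k ≤ n, (ω k).1 ≠ (ω k).2})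
        (fun k _ => h k) _
    simp only [h1, ENNReal.tsum_const_eq_top_of_ne_zero one_ne_zero, add_top, le_top]

namespace InnerMCMC

variable {X : Type*} [MeasurableSpace X] [MeasurableEq X] {S : ℕ} {T : TemperedTarget X S}
  (K : InnerMCMC T) {N : ℕ} [NeZero N]

theorem measurableSet_forall_le_ne (n : ℕ) :
    MeasurableSet {ω : ℕ → Traj X S × Traj X S | ∀ k ≤ n, (ω k).1 ≠ (ω k).2} := by
  have h : {ω : ℕ → Traj X S × Traj X S | ∀ k ≤ n, (ω k).1 ≠ (ω k).2} =
      ⋂ k, ⋂ (_ : k ≤ n), (fun ω => ω k) ⁻¹' {w : Traj X S × Traj X S | w.1 = w.2}ᶜ := by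
    ext ω; simp
  rw [h]
  exact MeasurableSet.iInter fun k => MeasurableSet.iInter fun _ =>
    measurable_pi_apply k measurableSet_traj_eq.compl

/-- Each transition multiplies the no-meeting probability by at most ρ. The exponent is n, not n +
1, because the initial pair is arbitrary. -/
theorem chainLaw_forall_le_ne (μ : Measure (Traj X S × Traj X S)) [IsProbabilityMeasure μ]
    {ρ : ℝ≥0∞} (hρ : ∀ z, K.coupledCSMC N z {w | w.1 = w.2}ᶜ ≤ ρ) (n : ℕ) :
    K.chainLaw N μ {ω | ∀ k ≤ n, (ω k).1 ≠ (ω k).2} ≤ ρ ^ n := by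
  have hprob : IsProbabilityMeasure (K.chainLaw N μ) := by
    unfold chainLaw; infer_instance
  induction n with
  | zero => rw [pow_zero]; exact prob_le_one
  | succ n ih =>
    let D : Set (Traj X S × Traj X S) := {w | w.1 = w.2}
    have hD : MeasurableSet D := measurableSet_traj_eq
    let B : Set ((i : Finset.Iic n) → Traj X S × Traj X S) := {h | ∀ i, h i ∈ Dᶜ}
    have hB : MeasurableSet B := by
      have h : B = ⋂ i, (fun h => h i) ⁻¹' Dᶜ := by ext; simp [B]
      rw [h]
      exact MeasurableSet.iInter fun i => measurable_pi_apply i hD.compl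
    have hBpre : (Preorder.frestrictLe n : (ℕ → Traj X S × Traj X S) → _) ⁻¹' B =
        {ω | ∀ k ≤ n, (ω k).1 ≠ (ω k).2} := by
      ext ω
      refine ⟨fun h k hk => h ⟨k, Finset.mem_Iic.2 hk⟩, fun h i => h i (Finset.mem_Iic.1 i.2)⟩
    have hfr : Measurable (Preorder.frestrictLe n :
        (ℕ → Traj X S × Traj X S) → (i : Finset.Iic n) → Traj X S × Traj X S) := by
      fun_prop
    have hset : {ω : ℕ → Traj X S × Traj X S | ∀ k ≤ n + 1, (ω k).1 ≠ (ω k).2} =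
        (fun ω => (Preorder.frestrictLe n ω, ω (n + 1))) ⁻¹' (B ×ˢ Dᶜ) := by
      rw [Set.mk_preimage_prod, hBpre]
      ext ω
      refine ⟨fun h => ⟨fun k hk => h k (Nat.le_succ_of_le hk), h (n + 1) le_rfl⟩,
        fun h k hk => ?_⟩
      rcases Nat.le_succ_iff.1 hk with hk | rfl
      · exact h.1 k hk
      · exact h.2
    let κ : (n : ℕ) → Kernel ((i : Finset.Iic n) → Traj X S × Traj X S) (Traj X S × Traj X S) :=
      fun n => (K.coupledCSMC N).comap (fun h => h ⟨n, Finset.mem_Iic.2 le_rfl⟩) (by fun_prop)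
    -- Markov property: the history up to n and the next pair have as joint law the history's law
    -- composed with the step kernel.
    have hmark := Kernel.map_frestrictLe_trajMeasure_compProd_eq_map_trajMeasure
      (X := fun _ => Traj X S × Traj X S) (μ₀ := μ) (κ := κ) (a := n)
    have hlaw : K.chainLaw N μ = Kernel.trajMeasure (X := fun _ => Traj X S × Traj X S) μ κ := rfl
    rw [← hlaw] at hmark
    rw [hset, ← Measure.map_apply (by fun_prop) (hB.prod hD.compl), ← hmark,
      Measure.compProd_apply_prod hB hD.compl]
    calc ∫⁻ h in B, κ n h Dᶜ ∂(K.chainLaw N μ).map (Preorder.frestrictLe n)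
        ≤ ∫⁻ _ in B, ρ ∂(K.chainLaw N μ).map (Preorder.frestrictLe n) :=
          lintegral_mono fun h => hρ _
      _ = ρ * K.chainLaw N μ {ω | ∀ k ≤ n, (ω k).1 ≠ (ω k).2} := by
          rw [setLIntegral_const, Measure.map_apply hfr hB, hBpre]
      _ ≤ ρ * ρ ^ n := by gcongr
      _ = ρ ^ (n + 1) := (pow_succ' ρ n).symm

/-- If each coupled step fails to make the chains meet with probability at most `ρ`, the meeting
time has at most the mean of one plus a geometric variable. -/
theorem chainLaw_meetingTime_le (μ : Measure (Traj X S × Traj X S)) [IsProbabilityMeasure μ]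
    {ρ : ℝ≥0∞} (hρ : ∀ z, K.coupledCSMC N z {w | w.1 = w.2}ᶜ ≤ ρ) (hρ1 : ρ < 1) :
    (∀ᵐ ω ∂K.chainLaw N μ, meetingTime ω < ∞) ∧
      ∫⁻ ω, meetingTime ω ∂K.chainLaw N μ ≤ 1 + (1 - ρ)⁻¹ := by
  have hprob : IsProbabilityMeasure (K.chainLaw N μ) := by
    unfold chainLaw; infer_instance
  have hm : ∀ n : ℕ, Measurable (Set.indicator
      {ω : ℕ → Traj X S × Traj X S | ∀ k ≤ n, (ω k).1 ≠ (ω k).2} (1 : (ℕ → Traj X S × Traj X S) → ℝ≥0∞)) := fun n =>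
    measurable_one.indicator (measurableSet_forall_le_ne n)
  have hle : ∫⁻ ω, (1 + ∑' n : ℕ, Set.indicator
      {ω : ℕ → Traj X S × Traj X S | ∀ k ≤ n, (ω k).1 ≠ (ω k).2} 1 ω) ∂K.chainLaw N μ ≤
      1 + (1 - ρ)⁻¹ := by
    rw [lintegral_add_left measurable_const, lintegral_const, measure_univ, mul_one,
      lintegral_tsum fun n => (hm n).aemeasurable, ← ENNReal.tsum_geometric]
    gcongr with n
    rw [lintegral_indicator_one (measurableSet_forall_le_ne n)]
    exact K.chainLaw_forall_le_ne μ hρ n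
  have hfin : 1 + (1 - ρ)⁻¹ ≠ ∞ :=
    ENNReal.add_ne_top.2 ⟨ENNReal.one_ne_top, ENNReal.inv_ne_top.2 (tsub_pos_of_lt hρ1).ne'⟩
  refine ⟨?_, (lintegral_mono meetingTime_le_one_add_tsum).trans hle⟩
  -- Finiteness is read off the measurable dominating series, so measurability of `meetingTime` is
  -- not required.
  filter_upwards [ae_lt_top (measurable_const.add (Measurable.tsum hm))
    (ne_top_of_le_ne_top hfin hle)] with ω hω
  exact (meetingTime_le_one_add_tsum ω).trans_lt hω

end InnerMCMC

end

theorem proposition1 {X : Type*} [MeasurableSpace X] [MeasurableEq X] (S : ℕ)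
    (T : TemperedTarget X S) (K : InnerMCMC T) (hL : BddAbove (Set.range T.lik)) :
    ∃ c : ℝ, 0 ≤ c ∧ ∀ (N : ℕ) [NeZero N], 2 ≤ N →
      (∀ z : Traj X S × Traj X S,
        (N : ℝ) / (N + c) ≤ (K.coupledCSMC N z).real {w | w.1 = w.2}) ∧
      (∀ (μ : Measure (Traj X S × Traj X S)) [IsProbabilityMeasure μ],
        (∀ᵐ ω ∂K.chainLaw N μ, meetingTime ω < ∞) ∧
        ∫⁻ ω, meetingTime ω ∂K.chainLaw N μ ≤ ENNReal.ofReal (2 + c / N)) ∧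
      (∀ᵐ ω ∂K.chainLaw N (K.initialPair N), meetingTime ω < ∞) ∧
      ∫⁻ ω, meetingTime ω ∂K.chainLaw N (K.initialPair N) ≤ ENNReal.ofReal (2 + c / N) := by
  obtain ⟨c, hc0, hc⟩ := K.exists_div_le_coupledCSMC_real hL
  refine ⟨c, hc0, fun N _ hN => ?_⟩
  have hNpos : (0 : ℝ) < N := by exact_mod_cast Nat.pos_of_neZero N
  have hr0 : (0 : ℝ) < N / (N + c) := by positivity
  have hr1 : (N : ℝ) / (N + c) ≤ 1 := (div_le_one (by positivity)).2 (by linarith)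
  have hρ : ∀ z, K.coupledCSMC N z {w | w.1 = w.2}ᶜ ≤ 1 - ENNReal.ofReal (N / (N + c)) := by
    intro z
    rw [prob_compl_eq_one_sub measurableSet_traj_eq]
    gcongr
    exact ENNReal.ofReal_le_of_le_toReal (hc N hN z)
  have hρ1 : 1 - ENNReal.ofReal (N / (N + c)) < 1 :=
    ENNReal.sub_lt_self ENNReal.one_ne_top one_ne_zero (ENNReal.ofReal_pos.2 hr0).ne'
  -- With success probability N/(N + c) the geometric bound is 1 + (N + c)/N = 2 + c/N.
  have hbound : 1 + (1 - (1 - ENNReal.ofReal ((N : ℝ) / (N + c))))⁻¹ =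
      ENNReal.ofReal (2 + c / N) := by
    rw [ENNReal.sub_sub_cancel ENNReal.one_ne_top (ENNReal.ofReal_le_one.2 hr1),
      ← ENNReal.ofReal_inv_of_pos hr0, ← ENNReal.ofReal_one,
      ← ENNReal.ofReal_add zero_le_one (by positivity)]
    congr 1
    field_simp
    ring
  have hmain : ∀ (μ : Measure (Traj X S × Traj X S)) [IsProbabilityMeasure μ],
      (∀ᵐ ω ∂K.chainLaw N μ, meetingTime ω < ∞) ∧
        ∫⁻ ω, meetingTime ω ∂K.chainLaw N μ ≤ ENNReal.ofReal (2 + c / N) := by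
    intro μ _
    rw [← hbound]
    exact K.chainLaw_meetingTime_le μ hρ hρ1
  exact ⟨hc N hN, fun μ _ => hmain μ, hmain (K.initialPair N)⟩
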